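/- **Machine model.** $P$ processors have unbounded local memories and exchange point-to-point messages. An arithmetic operation (field operation, complex conjugation, real square root) takes time $\gamma$; sending or receiving a message of $w$ complex words takes time $\alpha+w\beta$. An execution is a directed acyclic graph of tasks, with an edge from each task to the next one of the same processor and from each send to the matching receive; the runtime is the maximum weight of a path, vertices being weighted by the durations of their tasks. **Algorithm.** Let $P,m,n,b\ge 1$ be integers with $b\le n$ and $Pn\le m$. The rows of an $m\times n$ complex matrix $A$ are distributed over the $P$ processors in a balanced way (the numbers of rows owned by any two processors differ by at most one), and one processor, the root, owns the $n$ leading rows. 1D-CAQR-EG with recursion threshold $b$ computes a Householder representation $(V,T)$ of the Q-factor ($Q=I-VTV^H$; $V$ distributed like $A$, $T$ on the root) and the $n\times n$ R-factor (on the root). If $n\le b$, it calls TSQR: local QR decompositions, a binomial-tree reduction of the R-factors by QR decompositions of pairs of stacked R-factors, a binomial-tree downsweep that forms the first $n$ columns of the Q-factor, and the recovery of the Householder representation by a sign-modified LU elimination on the root, a binomial-tree broadcast of the triangular factor $U$, and local triangular solves. The local QR decompositions are done by any subroutine that decomposes $\mu\times\nu$ matrices, $\mu\ge\nu$, in $O(\mu\nu^2)$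 operations and returns the Q-factor as $I-VTV^H$ with $V$ of size $\mu\times\nu$ and $T$ of size $\nu\times\nu$. If $n>b$, it splits off the first $\lfloor n/2\rfloor$ columns, $A=\begin{bmatrix}A_{11}&A_{12}\\A_{21}&A_{22}\end{bmatrix}$ with $A_{11}$ square of order $\lfloor n/2\rfloor$, and computes $$(V_L,T_L,R_L)\ \text{recursively from}\ \begin{bmatrix}A_{11}\\A_{21}\end{bmatrix},\qquad M_1=V_L^H\begin{bmatrix}A_{12}\\A_{22}\end{bmatrix},\quad M_2=T_L^HM_1,\quad \begin{bmatrix}B_{12}\\B_{22}\end{bmatrix}=\begin{bmatrix}A_{12}\\A_{22}\end{bmatrix}-V_LM_2,$$ $$(V_R,T_R,R_R)\ \text{recursively from}\ B_{22},\qquad M_3=V_L^H\begin{bmatrix}0\\V_R\end{bmatrix},\quad M_4=M_3T_R,$$ $$V=\begin{bmatrix}V_L&\begin{bmatrix}0\\V_R\end{bmatrix}\end{bmatrix},\quad T=\begin{bmatrix}T_L&-T_LM_4\\0&T_R\end{bmatrix},\quad R=\begin{bmatrix}R_L&B_{12}\\0&R_R\end{bmatrix}.$$ The products giving $M_1$ and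 $M_3$ are local products followed by a bidirectional-exchange reduce to the root (reduce-scatter, then binomial-tree gather); $V_LM_2$ is a bidirectional-exchange broadcast of $M_2$ from the root (binomial-tree scatter, then all-gather) followed by local products; the other products are done by the root. **Lemma 6.** If $P=O(b^2)$, then 1D-CAQR-EG with recursion threshold $b$ has runtime $$\gamma\cdot O\!\left(\frac{mn^2}{P}+nb^2\log P\right)+\beta\cdot O\!\left(n^2+nb\log P\right)+\alpha\cdot O\!\left(\frac nb\log P\right),$$ uniformly in $m,n,P,b$, the matrix, the balanced distribution, the root and $\gamma,\beta,\alpha\ge 0$: the hidden constants depend only on the constant in $P=O(b^2)$ and on the constant in the operation count of the local QR subroutine. -/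

import Mathlib

noncomputable section

namespace ParQR

/-! ## The parallel machine

`P` processors with unbounded local memories.  A word is a complex number.  An execution is recorded
as a list of tasks.  The position of a task in the list has no influence on timing, apart from the
order it induces on the tasks of each single processor. -/

/-- A task: an arithmetic operation on processor `p`; the sending by `p` of a message of `w` words
to `q`; or the receiving by `q` of a message of `w` words from `p`, where `stamp` is the position
of the matching send in the list of tasks. -/
inductive Task (P : ℕ) where
  | op (p : Fin P)
  | send (p q : Fin P) (w : ℕ)
  | recv (q p : Fin P) (w : ℕ) (stamp : ℕ)

/-- The processor that performs a task. -/
def Task.proc {P : ℕ} : Task P → Fin P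
  | .op p => p
  | .send p _ _ => p
  | .recv q _ _ _ => q

/-- The duration of a task: `γ` for an operation, `α + w β` for sending or receiving `w` words. -/
def Task.duration {P : ℕ} (γ β α : ℝ) : Task P → ℝ
  | .op _ => γ
  | .send _ _ w => α + w * β
  | .recv _ _ w _ => α + w * β

/-- The edges of the execution graph, whose vertices are the positions in the list of tasks: from
each task to the next task of the same processor, and from each send to the matching receive. -/
def Edge {P : ℕ} (L : List (Task P)) (i j : ℕ) : Prop :=
  i < j ∧ ∃ s t : Task P, L[i]? = some s ∧ L[j]? = some t ∧
    ((s.proc = t.proc ∧ ∀ k u, i < k → k < j → L[k]? = some u → u.proc ≠ s.proc) ∨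
      ∃ (p q : Fin P) (w : ℕ), s = .send p q w ∧ t = .recv q p w i)

/-- A path in the execution graph: the list of its vertices. -/
def IsPath {P : ℕ} (L : List (Task P)) (π : List ℕ) : Prop :=
  (∀ i ∈ π, i < L.length) ∧ π.IsChain (Edge L)

/-- The weight of a path: the sum of the durations of its tasks. -/
def pathWeight {P : ℕ} (γ β α : ℝ) (L : List (Task P)) (π : List ℕ) : ℝ :=
  (π.map fun i => (L[i]?.map (Task.duration γ β α)).getD 0).sum

/-- The runtime of an execution: the maximum weight of a path (there are finitely many paths,
since vertices increase along edges). -/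
def runtime {P : ℕ} (γ β α : ℝ) (L : List (Task P)) : ℝ :=
  sSup {x | ∃ π, IsPath L π ∧ x = pathWeight γ β α L π}

/-! ## Local computation -/

/-- The result of a computation on one processor, with the number of operations performed. -/
structure Counted (α : Type) where
  val : α
  ops : ℕ

instance : Monad Counted where
  pure a := ⟨a, 0⟩
  bind x f := ⟨(f x.val).val, x.ops + (f x.val).ops⟩

/-- A matrix in the memory of a processor.  Its dimensions are kept separately: only the entries
with row and column index below the dimensions are meaningful.  Indices start from `0`. -/
abbrev Mat := ℕ → ℕ → ℂ

namespace Counted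

/-! The operations: the field actions, complex conjugation and real square roots. -/

def add (x y : ℂ) : Counted ℂ := ⟨x + y, 1⟩
def sub (x y : ℂ) : Counted ℂ := ⟨x - y, 1⟩
def mul (x y : ℂ) : Counted ℂ := ⟨x * y, 1⟩
def div (x y : ℂ) : Counted ℂ := ⟨x / y, 1⟩
def conj (x : ℂ) : Counted ℂ := ⟨star x, 1⟩
def sqrt (x : ℂ) : Counted ℂ := ⟨(Real.sqrt x.re : ℂ), 1⟩

/-- `z / |z|` for `z ≠ 0`, and `1` for `z = 0`. -/
def sgn (z : ℂ) : Counted ℂ :=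
  if z = 0 then pure 1 else do
    let w ← conj z
    let a ← mul z w
    let s ← sqrt a
    div z s

/-- Compute each entry of an `I × J` matrix. -/
def table (I J : ℕ) (f : ℕ → ℕ → Counted ℂ) : Counted Mat :=
  ⟨fun i j => if i < I ∧ j < J then (f i j).val else 0,
    ∑ i ∈ Finset.range I, ∑ j ∈ Finset.range J, (f i j).ops⟩

/-- The sum of products `∑ l < k, f l * g l`. -/
def dot (f g : ℕ → ℂ) : ℕ → Counted ℂ
  | 0 => pure 0
  | k + 1 => do
    let s ← dot f g k
    let x ← mul (f k) (g k)
    add s x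

/-- The product of an `I × K` matrix with a `K × J` matrix by the entrywise formula. -/
def matMul (I J K : ℕ) (A B : Mat) : Counted Mat :=
  table I J fun i j => dot (fun l => A i l) (fun l => B l j) K

/-- The conjugate transpose of an `I × J` matrix. -/
def adjoint (I J : ℕ) (A : Mat) : Counted Mat :=
  table J I fun i j => conj (A j i)

/-- The difference of two `I × J` matrices. -/
def matSub (I J : ℕ) (A B : Mat) : Counted Mat :=
  table I J fun i j => sub (A i j) (B i j)

/-- `(I - V T Vᴴ) X`, where `V` and `X` are `μ × ν` and `T` is `ν × ν`. -/
def applyQ (μ ν : ℕ) (V T X : Mat) : Counted Mat := do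
  let Vh ← adjoint μ ν V
  let M₁ ← matMul ν ν μ Vh X
  let M₂ ← matMul ν ν ν T M₁
  let Y ← matMul μ ν ν V M₂
  matSub μ ν X Y

/-- The first columns (as many as the last argument says) of the solution `X`, with `μ` rows, of
`X U = W`, where `U` is upper triangular. -/
def solveUpper (μ : ℕ) (U W : Mat) : ℕ → Counted Mat
  | 0 => pure fun _ _ => 0
  | j + 1 => do
    let X ← solveUpper μ U W j
    let x ← table μ 1 fun i _ => do
      let s ← dot (fun l => X i l) (fun l => U l j) j
      let d ← sub (W i j) s
      div d (U j j)
    pure fun i l => if l = j then x i 0 else X i l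

/-- The modified elimination on an `n × n` matrix `X`, after the number of columns given by the last
argument: just before column `j` is eliminated, `S j`, the sign of the current diagonal entry, is
added to that entry.  Returns `S` and the array that holds the multipliers (the strict lower triangle
of the unit lower triangular factor) and the reduced matrix. -/
def signedLU (n : ℕ) (X : Mat) : ℕ → Counted (Mat × (ℕ → ℂ))
  | 0 => pure (X, fun _ => 0)
  | j + 1 => do
    let (Y, S) ← signedLU n X j
    let s ← sgn (Y j j)
    let d ← add (Y j j) s
    let l ← table n 1 fun i _ => if j < i then div (Y i j) d else pure 0
    let Z ← table n n fun i k =>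
      if j < i ∧ j < k then do
        let t ← mul (l i 0) (Y j k)
        sub (Y i k) t
      else pure (Y i k)
    pure (fun i k => if k = j then (if i < j then Y i j else if i = j then d else l i 0) else Z i k,
      Function.update S j s)

/-- Add two blocks of words entrywise. -/
def addBlock : List ℂ → List ℂ → Counted (List ℂ)
  | x :: xs, y :: ys => do
    let z ← add x y
    let zs ← addBlock xs ys
    pure (z :: zs)
  | _, _ => pure []

/-- Add two lists of blocks blockwise. -/
def addBlocks : List (List ℂ) → List (List ℂ) → Counted (List (List ℂ))
  | x :: xs, y :: ys => do
    let z ← addBlock x y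
    let zs ← addBlocks xs ys
    pure (z :: zs)
  | _, _ => pure []

end Counted

/-! ### Rearranging data without arithmetic -/

/-- The matrix with blocks `A` (with `k` rows) above `B`. -/
def stack (k : ℕ) (A B : Mat) : Mat := fun i j => if i < k then A i j else B (i - k) j

/-- The `2 × 2` block matrix with a leading `k × k` block. -/
def blockMat (k : ℕ) (A B C D : Mat) : Mat := fun i j =>
  if i < k then (if j < k then A i j else B i (j - k))
  else (if j < k then C (i - k) j else D (i - k) (j - k))

/-- The words of an `I × J` matrix, row by row. -/
def pack (I J : ℕ) (A : Mat) : List ℂ :=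
  (List.range I).flatMap fun i => (List.range J).map fun j => A i j

/-- The matrix with `J` columns with the given words. -/
def unpack (J : ℕ) (x : List ℂ) : Mat := fun i j => x.getD (i * J + j) 0

/-- The `n (n + 1) / 2` words of the upper triangle of an `n × n` matrix, column by column. -/
def packUpper (n : ℕ) (A : Mat) : List ℂ :=
  (List.range n).flatMap fun j => (List.range (j + 1)).map fun i => A i j

/-- The `n × n` upper triangular matrix with the given words. -/
def unpackUpper (n : ℕ) (x : List ℂ) : Mat := fun i j =>
  if i ≤ j ∧ j < n then x.getD (j * (j + 1) / 2 + i) 0 else 0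

/-- The subroutine for QR decomposition on one processor, of which only this is specified: it
decomposes any `μ × ν` matrix with `μ ≥ ν`, in at most `c μ ν²` operations, and returns
`(V, T, R)`, where `V` is `μ × ν`, `T` is `ν × ν` and `R` is `ν × ν` upper triangular, such that
`Q = I - V T Vᴴ` is unitary and `A = Q [R; 0]`.  (Householder QR is an example.) -/
structure LocalQR (c : ℝ) where
  run : (μ ν : ℕ) → Mat → Counted (Mat × Mat × Mat)
  ops_le : ∀ (μ ν : ℕ) (A : Mat), ν ≤ μ → ((run μ ν A).ops : ℝ) ≤ c * μ * (ν : ℝ) ^ 2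
  upper : ∀ (μ ν : ℕ) (A : Mat), ν ≤ μ → ∀ i j, j < i → i < ν → (run μ ν A).val.2.2 i j = 0
  correct : ∀ (μ ν : ℕ) (A : Mat), ν ≤ μ →
    let V : Matrix (Fin μ) (Fin ν) ℂ := Matrix.of fun i j => (run μ ν A).val.1 i j
    let T : Matrix (Fin ν) (Fin ν) ℂ := Matrix.of fun i j => (run μ ν A).val.2.1 i j
    let R : Matrix (Fin μ) (Fin ν) ℂ :=
      Matrix.of fun i j => if (i : ℕ) < ν then (run μ ν A).val.2.2 i j else 0
    let Q : Matrix (Fin μ) (Fin μ) ℂ := 1 - V * T * V.conjTranspose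
    Q ∈ Matrix.unitaryGroup (Fin μ) ℂ ∧
      (Matrix.of fun (i : Fin μ) (j : Fin ν) => A i j) = Q * R

/-! ## Parallel computation

In a parallel program a family indexed by the processors describes distributed data: its member at
`p` is in the memory of `p`.  The programs are written so that a computation on `p` and a message
sent by `p` use only data in the memory of `p`; processors wait for each other only by receiving. -/

/-- Parallel programs: they extend the list of tasks performed so far. -/
abbrev Machine (P : ℕ) := StateM (List (Task P))

/-- A message in transit: a list of blocks of words. -/
structure Msg (P : ℕ) where
  src : Fin P
  dst : Fin P
  blocks : List (List ℂ)
  stamp : ℕ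

section Programs

variable {P : ℕ}

/-- Perform a local computation on processor `p`. -/
def onProc {α : Type} (p : Fin P) (x : Counted α) : Machine P α := fun L =>
  (x.val, L ++ List.replicate x.ops (Task.op p))

/-- Processor `p` sends a message, consisting of the given blocks, to `q`. -/
def send (p q : Fin P) (bs : List (List ℂ)) : Machine P (Msg P) := fun L =>
  (⟨p, q, bs, L.length⟩, L ++ [Task.send p q bs.flatten.length])

/-- The destination of a message receives it. -/
def recv (x : Msg P) : Machine P (List (List ℂ)) := fun L =>
  (x.blocks, L ++ [Task.recv x.dst x.src x.blocks.flatten.length x.stamp])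

/-- Each of the listed processors performs a local computation. -/
def onEach (f : Fin P → Counted Mat) : List (Fin P) → Machine P (Fin P → Mat)
  | [] => pure fun _ _ _ => 0
  | p :: ps => do
    let x ← onProc p (f p)
    let g ← onEach f ps
    pure (Function.update g p x)

/-- Send the listed messages (source, destination, blocks). -/
def sendAll : List (Fin P × Fin P × List (List ℂ)) → Machine P (List (Msg P))
  | [] => pure []
  | (p, q, bs) :: xs => do
    let y ← send p q bs
    let ys ← sendAll xs
    pure (y :: ys)

/-- Receive the listed messages; returns the receivers and the blocks received. -/
def recvAll : List (Msg P) → Machine P (List (Fin P × List (List ℂ)))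
  | [] => pure []
  | x :: xs => do
    let bs ← recv x
    let ys ← recvAll xs
    pure ((x.dst, bs) :: ys)

end Programs

/-- A binary tree whose leaves are processors.  The root processor of a vertex is the first leaf
below it.  Each vertex carries an item of type `σ`, in the memory of its root processor. -/
inductive ProcTree (P : ℕ) (σ : Type) where
  | leaf (p : Fin P) (x : σ)
  | node (x : σ) (l r : ProcTree P σ)

namespace ProcTree

def root {P : ℕ} {σ : Type} : ProcTree P σ → Fin P
  | leaf p _ => p
  | node _ l _ => l.root

def leaves {P : ℕ} {σ : Type} : ProcTree P σ → List (Fin P)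
  | leaf p _ => [p]
  | node _ l r => l.leaves ++ r.leaves

/-- The binomial tree on the processors `p :: ps`, with root processor `p`: a set of `s > 1`
processors is split into sets of `⌈s/2⌉` and `⌊s/2⌋` processors. -/
def build {P : ℕ} (p : Fin P) (ps : List (Fin P)) : ProcTree P Unit :=
  match h : ps.drop ((ps.length + 2) / 2 - 1) with
  | [] => leaf p ()
  | q :: qs => node () (build p (ps.take ((ps.length + 2) / 2 - 1))) (build q qs)
termination_by ps.length
decreasing_by
  · have := congrArg List.length h
    simp at this ⊢
    omega
  · have := congrArg List.length h
    simp at this ⊢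
    omega

end ProcTree

section Collectives

variable {P : ℕ}

/-- The block for `d` in a list of blocks whose destinations are `ds`. -/
def pick (ds : List (Fin P)) (bs : List (List ℂ)) (d : Fin P) : List ℂ := bs.getD (ds.idxOf d) []

/-- Binomial-tree scatter: the root holds a block for each processor. -/
def scatter : ProcTree P Unit → (Fin P → List ℂ) → Machine P (Fin P → List ℂ)
  | .leaf _ _, D => pure D
  | .node _ l r, D => do
    let x ← send l.root r.root (r.leaves.map D)
    let bs ← recv x
    let X ← scatter l D
    let Y ← scatter r (pick r.leaves bs)
    pure fun p => if p ∈ r.leaves then Y p else X p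

/-- Binomial-tree gather: processor `p` holds the block `X p`; the root obtains all the blocks. -/
def gather (X : Fin P → List ℂ) : ProcTree P Unit → Machine P (Fin P → List ℂ)
  | .leaf p _ => pure fun _ => X p
  | .node _ l r => do
    let A ← gather X l
    let B ← gather X r
    let x ← send r.root l.root (r.leaves.map B)
    let bs ← recv x
    pure fun p => if p ∈ r.leaves then pick r.leaves bs p else A p

/-- Binomial-tree broadcast of one block from the root. -/
def treeBroadcast : ProcTree P Unit → List ℂ → Machine P (Fin P → List ℂ)
  | .leaf _ _, b => pure fun _ => b
  | .node _ l r, b => do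
    let x ← send l.root r.root [b]
    let bs ← recv x
    let X ← treeBroadcast l b
    let Y ← treeBroadcast r bs.flatten
    pure fun p => if p ∈ r.leaves then Y p else X p

/-- Each receiver `q` of blocks for the destinations `ds` adds them to its own blocks `D q`. -/
def accumulate (ds : List (Fin P)) :
    List (Fin P × List (List ℂ)) → (Fin P → Fin P → List ℂ) → Machine P (Fin P → Fin P → List ℂ)
  | [], D => pure D
  | (q, bs) :: xs, D => do
    let new ← onProc q (Counted.addBlocks (ds.map (D q)) bs)
    accumulate ds xs (Function.update D q fun d => if d ∈ ds then pick ds new d else D q d)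

/-- All pairs of processors of two sets `ls`, `rs` that exchange data, where `ls` may have one more
element than `rs`: then the last processor of `rs` occurs in two pairs. -/
def pairs (ls rs : List (Fin P)) : List (Fin P × Fin P) := ls.zip (rs ++ rs.getLast?.toList)

/-- Bidirectional-exchange reduce-scatter: processor `p` holds a block `D p d` for each `d`;
processor `d` obtains the entrywise sum of the blocks for `d`. -/
def reduceScatter :
    ProcTree P Unit → (Fin P → Fin P → List ℂ) → Machine P (Fin P → List ℂ)
  | .leaf p _, D => pure fun _ => D p p
  | .node _ l r, D => do
    let toR ← sendAll ((pairs l.leaves r.leaves).map fun e => (e.1, e.2, r.leaves.map (D e.1)))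
    let toL ← sendAll ((l.leaves.zip r.leaves).map fun e => (e.2, e.1, l.leaves.map (D e.2)))
    let inR ← recvAll toR
    let inL ← recvAll toL
    let D₁ ← accumulate r.leaves inR D
    let D₂ ← accumulate l.leaves inL D₁
    let X ← reduceScatter l D₂
    let Y ← reduceScatter r D₂
    pure fun p => if p ∈ r.leaves then Y p else X p

/-- Bidirectional-exchange all-gather: processor `p` holds the block `X p`; each processor obtains
all the blocks. -/
def allGather (X : Fin P → List ℂ) : ProcTree P Unit → Machine P (Fin P → Fin P → List ℂ)
  | .leaf p _ => pure fun _ _ => X p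
  | .node _ l r => do
    let A ← allGather X l
    let B ← allGather X r
    let toR ← sendAll ((l.leaves.zip r.leaves).map fun e => (e.1, e.2, l.leaves.map (A e.1)))
    let toL ← sendAll ((pairs l.leaves r.leaves).map fun e => (e.2, e.1, r.leaves.map (B e.2)))
    let inR ← recvAll toR
    let inL ← recvAll toL
    pure fun p d =>
      if p ∈ r.leaves then
        if d ∈ r.leaves then B p d else pick l.leaves ((inR.lookup p).getD []) d
      else
        if d ∈ r.leaves then pick r.leaves ((inL.lookup p).getD []) d else A p d

/-- Block `d` when `w` words are split into `P` blocks of at most `⌈w / P⌉` words. -/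
def chunk (w : ℕ) (x : List ℂ) (d : Fin P) : List ℂ := (x.drop (d * (w ⌈/⌉ P))).take (w ⌈/⌉ P)

/-- Bidirectional-exchange reduce: the root obtains the entrywise sum of blocks of `w` words. -/
def reduce (t : ProcTree P Unit) (w : ℕ) (X : Fin P → List ℂ) : Machine P (List ℂ) := do
  let Y ← reduceScatter t fun p d => chunk w (X p) d
  let Z ← gather Y t
  pure ((List.finRange P).flatMap Z)

/-- Bidirectional-exchange broadcast of a block of `w` words from the root. -/
def broadcast (t : ProcTree P Unit) (w : ℕ) (x : List ℂ) : Machine P (Fin P → List ℂ) := do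
  let Y ← scatter t (chunk w x)
  let Z ← allGather Y t
  pure fun p => (List.finRange P).flatMap (Z p)

end Collectives

section Algorithms

variable {P : ℕ}

/-! ### 1D matrix multiplication -/

/-- `∑ p, (X p)ᴴ (Y p)`, where `X p` is `mp p × I` and `Y p` is `mp p × J`, returned on the root. -/
def mulReduce (t : ProcTree P Unit) (mp : Fin P → ℕ) (I J : ℕ) (X Y : Fin P → Mat) :
    Machine P Mat := do
  let Z ← onEach (fun p => do
    let Xh ← Counted.adjoint (mp p) I (X p)
    Counted.matMul I J (mp p) Xh (Y p)) t.leaves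
  let z ← reduce t (I * J) fun p => pack I J (Z p)
  pure (unpack J z)

/-- The products `(X p) B`, where `X p` is `mp p × K` and `B` is a `K × J` matrix on the root. -/
def mulBroadcast (t : ProcTree P Unit) (mp : Fin P → ℕ) (K J : ℕ) (X : Fin P → Mat) (B : Mat) :
    Machine P (Fin P → Mat) := do
  let bs ← broadcast t (K * J) (pack K J B)
  onEach (fun p => Counted.matMul (mp p) J K (X p) (unpack J (bs p))) t.leaves

/-! ### TSQR -/

variable {c : ℝ}

/-- The upsweep: local QR decompositions, then a binomial-tree reduction of the R-factors in which
addition is replaced by QR decomposition of two stacked R-factors.  Returns the final R-factor, on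
the root, and the tree of Q-factors in basis-kernel representation. -/
def upsweep (Q : LocalQR c) (n : ℕ) (mp : Fin P → ℕ) (A : Fin P → Mat) :
    ProcTree P Unit → Machine P (Mat × ProcTree P (Mat × Mat))
  | .leaf p _ => do
    let (V, T, R) ← onProc p (Q.run (mp p) n (A p))
    pure (R, .leaf p (V, T))
  | .node _ l r => do
    let (R₁, l₁) ← upsweep Q n mp A l
    let (R₂, r₁) ← upsweep Q n mp A r
    let x ← send r.root l.root [packUpper n R₂]
    let bs ← recv x
    let (V, T, R) ← onProc l.root (Q.run (2 * n) n (stack n R₁ (unpackUpper n bs.flatten)))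
    pure (R, .node (V, T) l₁ r₁)

/-- The downsweep: the tree of Q-factors is applied to an `n × n` matrix `B` on the root (padded by
zeros), reversing the communication of the upsweep; `W` is where the results are stored. -/
def downsweep (n : ℕ) (mp : Fin P → ℕ) :
    ProcTree P (Mat × Mat) → Mat → (Fin P → Mat) → Machine P (Fin P → Mat)
  | .leaf p F, B, W => do
    let X ← onProc p (Counted.applyQ (mp p) n F.1 F.2 (stack n B fun _ _ => 0))
    pure (Function.update W p X)
  | .node F l r, B, W => do
    let Y ← onProc l.root (Counted.applyQ (2 * n) n F.1 F.2 (stack n B fun _ _ => 0))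
    let x ← send l.root r.root [pack n n fun i j => Y (n + i) j]
    let bs ← recv x
    let W₁ ← downsweep n mp l Y W
    downsweep n mp r (unpack n bs.flatten) W₁

/-- TSQR of the matrix with `n` columns whose rows on processor `p` form the `mp p × n` matrix
`A p`, the first `n` rows on the root being its leading rows.  Returns the basis `V` (distributed
like `A`), and the kernel `T` and the R-factor on the root. -/
def tsqr (Q : LocalQR c) (t : ProcTree P Unit) (n : ℕ) (mp : Fin P → ℕ) (A : Fin P → Mat) :
    Machine P ((Fin P → Mat) × Mat × Mat) := do
  let r := t.root
  let (R₀, F) ← upsweep Q n mp A t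
  let W ← downsweep n mp F (fun i j => if i = j then 1 else 0) fun _ _ _ => 0
  let (X, S) ← onProc r (Counted.signedLU n (W r) n)
  let L : Mat := fun i j => if j < i then X i j else if i = j then 1 else 0
  let U : Mat := fun i j => if i ≤ j then X i j else 0
  let T ← onProc r (do
    let Lh ← Counted.adjoint n n L
    let Y ← Counted.table n n fun i j => do
      let s ← Counted.conj (S j)
      Counted.mul (U i j) s
    Counted.solveUpper n Lh Y n)
  let R ← onProc r (Counted.table n n fun i j =>
    if i ≤ j then do
      let x ← Counted.mul (S i) (R₀ i j)
      Counted.sub 0 x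
    else pure 0)
  let us ← treeBroadcast t (packUpper n U)
  let V ← onEach (fun p =>
    if p = r then do
      let Y ← Counted.solveUpper (mp r - n) (unpackUpper n (us r)) (fun i j => W r (n + i) j) n
      pure (stack n L Y)
    else Counted.solveUpper (mp p) (unpackUpper n (us p)) (W p) n) t.leaves
  pure (V, T, R)

/-! ### 1D-CAQR-EG -/

/-- 1D-CAQR-EG with recursion threshold `b`; input and output are distributed as for `tsqr`. -/
def caqr (Q : LocalQR c) (t : ProcTree P Unit) (b : ℕ) (hb : 0 < b) (n : ℕ) (mp : Fin P → ℕ)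
    (A : Fin P → Mat) : Machine P ((Fin P → Mat) × Mat × Mat) :=
  if _hn : n ≤ b then tsqr Q t n mp A else do
    let r := t.root
    let k := n / 2
    let k' := n - n / 2
    let (VL, TL, RL) ← caqr Q t b hb (n / 2) mp A
    let A₂ : Fin P → Mat := fun p i j => A p i (k + j)
    let M₁ ← mulReduce t mp k k' VL A₂
    let M₂ ← onProc r (do
      let Th ← Counted.adjoint k k TL
      Counted.matMul k k' k Th M₁)
    let Y ← mulBroadcast t mp k k' VL M₂
    let B ← onEach (fun p => Counted.matSub (mp p) k' (A₂ p) (Y p)) t.leaves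
    -- the leading `k` rows, which are on the root, are excluded from the right recursive call
    let s : Fin P → ℕ := fun p => if p = r then k else 0
    let (VR, TR, RR) ← caqr Q t b hb (n - n / 2) (fun p => mp p - s p) fun p i j => B p (s p + i) j
    let V : Fin P → Mat := fun p i j =>
      if j < k then VL p i j else if i < s p then 0 else VR p (i - s p) (j - k)
    let M₃ ← mulReduce t (fun p => mp p - s p) k k' (fun p i j => VL p (s p + i) j) VR
    let M₄ ← onProc r (Counted.matMul k k' k' M₃ TR)
    let N ← onProc r (do
      let X ← Counted.matMul k k' k TL M₄
      Counted.table k k' fun i j => Counted.sub 0 (X i j))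
    pure (V, blockMat k TL N (fun _ _ => 0) TR, blockMat k RL (B r) (fun _ _ => 0) RR)
termination_by n
decreasing_by all_goals omega

/-! ### Input distribution -/

/-- The rows owned by processor `p`, in increasing order, when processor `own i` owns row `i`. -/
def ownedRows {m : ℕ} (own : Fin m → Fin P) (p : Fin P) : List (Fin m) :=
  (List.finRange m).filter fun i => own i = p

/-- The rows of `A` owned by processor `p`. -/
def ownedBlock {m n : ℕ} (own : Fin m → Fin P) (A : Matrix (Fin m) (Fin n) ℂ) (p : Fin P) : Mat :=
  fun i j =>
    if h : i < (ownedRows own p).length ∧ j < n then A ((ownedRows own p)[i]'h.1) ⟨j, h.2⟩ else 0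

/-- The execution of 1D-CAQR-EG with recursion threshold `b` on the `m × n` matrix `A`, whose row
`i` is owned by processor `own i`, with root processor `r`. -/
def caqrExecution (Q : LocalQR c) {m n : ℕ} (b : ℕ) (hb : 0 < b) (r : Fin P) (own : Fin m → Fin P)
    (A : Matrix (Fin m) (Fin n) ℂ) : List (Task P) :=
  ((caqr Q (ProcTree.build r ((List.finRange P).filter fun p => p ≠ r)) b hb n
    (fun p => (ownedRows own p).length) (ownedBlock own A)).run []).2

end Algorithms

end ParQR

end

open ParQR

/-! Let every task start as soon as its processor is free and, for a receive, the matching send is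
finished. Along each edge of the execution graph the finishing time then grows by at least the
duration of the target, so the weight of a path telescopes to at most the largest clock
(`runtime_le`). It remains to bound clocks.

This is done compositionally by `Takes`: from any earlier history, a program delays a common bound
on the clocks of its processors by at most a given number of operations, words and messages. Costs
add under sequential composition (`Takes.bind`), while programs on disjoint sets of processors need
only a common bound (`Takes.par`), because the position in the list of tasks does not affect clocks
of other processors.

For blocks of `h` words, a scatter, gather, reduce-scatter or all-gather moves `O(h)` times the sum
of the set sizes along one branch of the processor tree. These sizes halve, so the sum is `O(P)`,
and the branch has `O(log P)` vertices. Cutting `w` words into `P` blocks thus gives collectives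
with `O(w + P)` words and `O(log P)` messages. TSQR, with at most `μ` rows per processor, takes
`O(μn² + n³ log P)` operations, `O(n² log P)` words and `O(log P)` messages.

One level of the recursion (`Takes.caqr`) adds `O(μn² + P)` operations, `O(n² + P)` words and `O(log
P)` messages. Above the threshold `P = O(b²) = O(n²)`, so the term `P` disappears. The squares of
the two half widths sum to at most `3/4` of `n²`, so the quadratic terms decay geometrically and the
top level dominates. The base cases have widths between `b/2` and `b` with sum `n`; hence there are
`O(n/b)` of them, and they contribute the three terms with `log P`. Balance gives `μ ≤ m/P + 1 ≤
2m/P`. -/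

namespace ParQR

/-! ## Timing of executions -/

/-- Nonnegative durations of an operation, a word and a message. -/
structure Rates where
  γ : ℝ
  β : ℝ
  α : ℝ
  γ_nonneg : 0 ≤ γ
  β_nonneg : 0 ≤ β
  α_nonneg : 0 ≤ α

namespace Rates

/-- The time taken by `a` operations, `b` words and `c` messages. -/
def cost (ρ : Rates) (a b c : ℝ) : ℝ := ρ.γ * a + ρ.β * b + ρ.α * c

theorem cost_mono (ρ : Rates) {a b c a' b' c' : ℝ} (ha : a ≤ a') (hb : b ≤ b') (hc : c ≤ c') :
    ρ.cost a b c ≤ ρ.cost a' b' c' := by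
  have := mul_le_mul_of_nonneg_left ha ρ.γ_nonneg
  have := mul_le_mul_of_nonneg_left hb ρ.β_nonneg
  have := mul_le_mul_of_nonneg_left hc ρ.α_nonneg
  unfold cost
  linarith

theorem cost_nonneg (ρ : Rates) {a b c : ℝ} (ha : 0 ≤ a) (hb : 0 ≤ b) (hc : 0 ≤ c) :
    0 ≤ ρ.cost a b c := by
  have := ρ.cost_mono ha hb hc
  simpa [cost] using this

end Rates

variable {P : ℕ}

/-- The duration of a task at given rates. -/
def Task.time (ρ : Rates) (t : Task P) : ℝ := t.duration ρ.γ ρ.β ρ.α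

theorem Task.time_nonneg (ρ : Rates) (t : Task P) : 0 ≤ t.time ρ := by
  have := ρ.γ_nonneg
  have := ρ.β_nonneg
  have := ρ.α_nonneg
  cases t <;> simp only [time, duration] <;> positivity

/-- The earliest start of a task, when `s` holds the clocks of the processors and the finishing
times of the earlier tasks. -/
def readyTime (s : (Fin P → ℝ) × List ℝ) : Task P → ℝ
  | .recv q _ _ i => max (s.1 q) (s.2.getD i 0)
  | .op p => s.1 p
  | .send p _ _ => s.1 p

/-- The clocks of the processors and the finishing times of the tasks, after one more task. -/
def advance (ρ : Rates) (s : (Fin P → ℝ) × List ℝ) (t : Task P) : (Fin P → ℝ) × List ℝ :=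
  (Function.update s.1 t.proc (readyTime s t + t.time ρ), s.2 ++ [readyTime s t + t.time ρ])

/-- The clocks of the processors and the finishing times of the tasks, after a list of tasks. -/
def timing (ρ : Rates) (L : List (Task P)) : (Fin P → ℝ) × List ℝ :=
  L.foldl (advance ρ) (fun _ => 0, [])

/-- The time at which a processor has performed its tasks. -/
def clock (ρ : Rates) (L : List (Task P)) (p : Fin P) : ℝ := (timing ρ L).1 p

/-- The time at which a task finishes. -/
def finish (ρ : Rates) (L : List (Task P)) (i : ℕ) : ℝ := (timing ρ L).2.getD i 0

theorem timing_append (ρ : Rates) (L : List (Task P)) (t : Task P) :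
    timing ρ (L ++ [t]) = advance ρ (timing ρ L) t := by
  simp [timing]

theorem length_timing (ρ : Rates) (L : List (Task P)) : (timing ρ L).2.length = L.length := by
  induction L using List.reverseRecOn with
  | nil => rfl
  | append_singleton L t ih => simp [timing_append, advance, ih]

theorem clock_append (ρ : Rates) (L : List (Task P)) (t : Task P) :
    clock ρ (L ++ [t]) =
      Function.update (clock ρ L) t.proc (readyTime (timing ρ L) t + t.time ρ) := by
  funext p
  simp only [clock, timing_append, advance]
  rfl

theorem finish_append_of_lt (ρ : Rates) (L : List (Task P)) (t : Task P) {i : ℕ}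
    (h : i < L.length) : finish ρ (L ++ [t]) i = finish ρ L i := by
  simp only [finish, timing_append, advance]
  rw [List.getD_append _ _ _ _ (by rw [length_timing]; exact h)]

theorem finish_append_length (ρ : Rates) (L : List (Task P)) (t : Task P) :
    finish ρ (L ++ [t]) L.length = readyTime (timing ρ L) t + t.time ρ := by
  simp only [finish, timing_append, advance]
  rw [List.getD_append_right _ _ _ _ (by rw [length_timing]), length_timing]
  simp

theorem clock_proc_le_readyTime (ρ : Rates) (L : List (Task P)) (t : Task P) :
    clock ρ L t.proc ≤ readyTime (timing ρ L) t := by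
  cases t with
  | op p => exact le_rfl
  | send p q w => exact le_rfl
  | recv q p w i => exact le_max_left _ _

theorem clock_le_append (ρ : Rates) (L : List (Task P)) (t : Task P) (p : Fin P) :
    clock ρ L p ≤ clock ρ (L ++ [t]) p := by
  rw [clock_append]
  by_cases h : p = t.proc
  · subst h
    rw [Function.update_self]
    have := clock_proc_le_readyTime ρ L t
    have := t.time_nonneg ρ
    linarith
  · rw [Function.update_of_ne h]

theorem clock_nonneg (ρ : Rates) (L : List (Task P)) (p : Fin P) : 0 ≤ clock ρ L p := by
  induction L using List.reverseRecOn with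
  | nil => exact le_rfl
  | append_singleton L t ih => exact ih.trans (clock_le_append ρ L t p)

theorem finish_le_clock (ρ : Rates) (L : List (Task P)) {i : ℕ} {s : Task P}
    (h : L[i]? = some s) : finish ρ L i ≤ clock ρ L s.proc := by
  induction L using List.reverseRecOn with
  | nil => simp at h
  | append_singleton L t ih =>
    rcases lt_trichotomy i L.length with hi | hi | hi
    · rw [List.getElem?_append_left hi] at h
      rw [finish_append_of_lt ρ L t hi]
      exact (ih h).trans (clock_le_append ρ L t _)
    · subst hi
      simp at h
      subst h
      rw [finish_append_length, clock_append, Function.update_self]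
    · rw [List.getElem?_eq_none (by simp; omega)] at h
      simp at h

theorem time_le_finish (ρ : Rates) (L : List (Task P)) {j : ℕ} {t : Task P}
    (h : L[j]? = some t) : t.time ρ ≤ finish ρ L j := by
  induction L using List.reverseRecOn with
  | nil => simp at h
  | append_singleton L u ih =>
    rcases lt_trichotomy j L.length with hj | hj | hj
    · rw [List.getElem?_append_left hj] at h
      rw [finish_append_of_lt ρ L u hj]
      exact ih h
    · subst hj
      simp at h
      subst h
      rw [finish_append_length]
      have := clock_proc_le_readyTime ρ L u
      have := clock_nonneg ρ L u.proc
      linarith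
    · rw [List.getElem?_eq_none (by simp; omega)] at h
      simp at h

/-- Both kinds of edges are respected by `readyTime`: it is at least the clock of the processor,
which bounds all its earlier finishing times, and for a receive it is at least the finishing time of
the send. -/
theorem finish_add_time_le_of_edge (ρ : Rates) (L : List (Task P)) {i j : ℕ} {t : Task P}
    (h : Edge L i j) (ht : L[j]? = some t) : finish ρ L i + t.time ρ ≤ finish ρ L j := by
  induction L using List.reverseRecOn with
  | nil => simp at ht
  | append_singleton L u ih =>
    obtain ⟨hij, s, t', hs, ht', h⟩ := h
    obtain rfl : t' = t := by rw [ht] at ht'; exact (Option.some.inj ht').symm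
    rcases lt_trichotomy j L.length with hj | hj | hj
    · rw [List.getElem?_append_left hj] at ht
      rw [List.getElem?_append_left (hij.trans hj)] at hs
      rw [finish_append_of_lt ρ L u hj, finish_append_of_lt ρ L u (hij.trans hj)]
      refine ih ⟨hij, s, t', hs, ht, h.imp_left fun h => ⟨h.1, fun k v h₁ h₂ hk => ?_⟩⟩ ht
      exact h.2 k v h₁ h₂ (by rw [List.getElem?_append_left (h₂.trans hj)]; exact hk)
    · subst hj
      simp at ht
      subst ht
      rw [List.getElem?_append_left hij] at hs
      rw [finish_append_of_lt ρ L u hij, finish_append_length]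
      gcongr
      rcases h with h | ⟨p, q, w, -, rfl⟩
      · refine (finish_le_clock ρ L hs).trans ?_
        rw [h.1]
        exact clock_proc_le_readyTime ρ L u
      · exact le_max_right _ _
    · rw [List.getElem?_eq_none (by simp; omega)] at ht
      simp at ht

/-- The durations after the first vertex telescope against differences of finishing times. -/
theorem sum_time_le_of_chain (ρ : Rates) (L : List (Task P)) (B : ℝ)
    (hB : ∀ p, clock ρ L p ≤ B) (π : List ℕ) (i : ℕ) (h : IsPath L (i :: π)) :
    pathWeight ρ.γ ρ.β ρ.α L π ≤ B - finish ρ L i := by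
  induction π generalizing i with
  | nil =>
    have hi : i < L.length := h.1 i (by simp)
    have := finish_le_clock ρ L (List.getElem?_eq_getElem hi)
    have := hB (L[i]).proc
    simp only [pathWeight, List.map_nil, List.sum_nil]
    linarith
  | cons j π ih =>
    have hj : j < L.length := h.1 j (by simp)
    obtain ⟨he, hc⟩ := List.isChain_cons_cons.1 h.2
    have h₁ := ih j ⟨fun k hk => h.1 k (List.mem_cons_of_mem _ hk), hc⟩
    have h₂ := finish_add_time_le_of_edge ρ L he (List.getElem?_eq_getElem hj)
    have h₃ : pathWeight ρ.γ ρ.β ρ.α L (j :: π) =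
        (L[j]).time ρ + pathWeight ρ.γ ρ.β ρ.α L π := by
      simp [pathWeight, Task.time, List.getElem?_eq_getElem hj]
    linarith

/-- The runtime is at most any bound on the clocks. -/
theorem runtime_le (ρ : Rates) (L : List (Task P)) (B : ℝ) (hB₀ : 0 ≤ B)
    (hB : ∀ p, clock ρ L p ≤ B) : runtime ρ.γ ρ.β ρ.α L ≤ B := by
  refine Real.sSup_le ?_ hB₀
  rintro x ⟨π, hπ, rfl⟩
  cases π with
  | nil => simpa [pathWeight] using hB₀
  | cons i π =>
    have hi : i < L.length := hπ.1 i (by simp)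
    have h₁ := sum_time_le_of_chain ρ L B hB π i hπ
    have h₂ := time_le_finish ρ L (List.getElem?_eq_getElem hi)
    have h₃ : pathWeight ρ.γ ρ.β ρ.α L (i :: π) =
        (L[i]).time ρ + pathWeight ρ.γ ρ.β ρ.α L π := by
      simp [pathWeight, Task.time, List.getElem?_eq_getElem hi]
    linarith

/-! ## Program logic -/

/-- The program `x` involves only the processors in `S`; started when their clocks are at most `t`
it ends when they are at most `t` plus the time of `a` operations, `b` words and `c` messages; and
its result satisfies `post`. -/
def Takes {σ : Type} (ρ : Rates) (x : Machine P σ) (S : List (Fin P)) (a b c : ℝ)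
    (post : σ → Prop) : Prop :=
  ∀ L, post (x.run L).1 ∧ (∀ p ∉ S, clock ρ (x.run L).2 p = clock ρ L p) ∧
    ∀ t, (∀ p ∈ S, clock ρ L p ≤ t) → ∀ p ∈ S, clock ρ (x.run L).2 p ≤ t + ρ.cost a b c

namespace Takes

variable {σ τ υ : Type} {ρ : Rates} {S S₁ S₂ : List (Fin P)} {a b c a₁ b₁ c₁ : ℝ}
  {post : σ → Prop}

theorem mono {x : Machine P σ} {post' : σ → Prop} (h : Takes ρ x S a₁ b₁ c₁ post)
    (ha : a₁ ≤ a) (hb : b₁ ≤ b) (hc : c₁ ≤ c) (hp : ∀ v, post v → post' v) :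
    Takes ρ x S a b c post' := fun L =>
  ⟨hp _ (h L).1, (h L).2.1, fun t ht p hpS =>
    ((h L).2.2 t ht p hpS).trans (by gcongr; exact ρ.cost_mono ha hb hc)⟩

theorem frame {x : Machine P σ} (h : Takes ρ x S₁ a b c post) (hS : ∀ p ∈ S₁, p ∈ S)
    (ha : 0 ≤ a) (hb : 0 ≤ b) (hc : 0 ≤ c) : Takes ρ x S a b c post := fun L =>
  ⟨(h L).1, fun p hp => (h L).2.1 p fun hp' => hp (hS p hp'), fun t ht p hpS => by
    by_cases hp : p ∈ S₁
    · exact (h L).2.2 t (fun q hq => ht q (hS q hq)) p hp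
    · rw [(h L).2.1 p hp]
      have := ρ.cost_nonneg ha hb hc
      linarith [ht p hpS]⟩

theorem pure' {v : σ} (hv : post v) (ha : 0 ≤ a) (hb : 0 ≤ b) (hc : 0 ≤ c) :
    Takes ρ (pure v : Machine P σ) S a b c post := fun _ =>
  ⟨hv, fun _ _ => rfl, fun _ ht p hp =>
    (ht p hp).trans (le_add_of_nonneg_right (ρ.cost_nonneg ha hb hc))⟩

/-- The continuation receives what is left of the budget, so a chain of steps never needs
intermediate totals: the arithmetic is settled once, where the final `pure'` asks for nonnegative
remainders. -/
theorem bind {x : Machine P σ} {f : σ → Machine P τ} {post' : τ → Prop}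
    (hx : Takes ρ x S a₁ b₁ c₁ post)
    (hf : ∀ v, post v → Takes ρ (f v) S (a - a₁) (b - b₁) (c - c₁) post') :
    Takes ρ (x >>= f) S a b c post' := fun L => by
  obtain ⟨h₁, h₂, h₃⟩ := hx L
  obtain ⟨k₁, k₂, k₃⟩ := hf _ h₁ (x.run L).2
  refine ⟨k₁, fun p hp => (k₂ p hp).trans (h₂ p hp), fun t ht p hp => ?_⟩
  refine (k₃ _ (h₃ t ht) p hp).trans (le_of_eq ?_)
  simp only [Rates.cost]
  ring

/-- Two programs on disjoint sets of processors run in parallel. -/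
theorem par {x : Machine P σ} {f : σ → Machine P τ} {g : σ → τ → Machine P υ}
    {post₂ : τ → Prop} {post' : υ → Prop}
    (hd : ∀ p ∈ S₁, p ∉ S₂) (hx : Takes ρ x S₁ a₁ b₁ c₁ post)
    (hf : ∀ v, post v → Takes ρ (f v) S₂ a₁ b₁ c₁ post₂)
    (hg : ∀ v w, post v → post₂ w →
      Takes ρ (g v w) (S₁ ++ S₂) (a - a₁) (b - b₁) (c - c₁) post') :
    Takes ρ (x >>= fun v => f v >>= g v) (S₁ ++ S₂) a b c post' := fun L => by
  obtain ⟨h₁, h₂, h₃⟩ := hx L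
  obtain ⟨k₁, k₂, k₃⟩ := hf _ h₁ (x.run L).2
  obtain ⟨l₁, l₂, l₃⟩ := hg _ _ h₁ k₁ ((f (x.run L).1).run (x.run L).2).2
  refine ⟨l₁, fun p hp => ?_, fun t ht p hp => ?_⟩
  · rw [List.mem_append, not_or] at hp
    exact (l₂ p (by simp [hp])).trans ((k₂ p hp.2).trans (h₂ p hp.1))
  · refine (l₃ (t + ρ.cost a₁ b₁ c₁) (fun q hq => ?_) p hp).trans (le_of_eq ?_)
    · by_cases hq' : q ∈ S₂
      · refine k₃ t (fun q hq => ?_) q hq'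
        -- The first program has left the clocks of `S₂` alone, so the second one effectively starts
        -- at the same time `t`.
        rw [h₂ q fun h => hd q h hq]
        exact ht q (by simp [hq])
      · rw [k₂ q hq']
        have : q ∈ S₁ := by
          rw [List.mem_append] at hq
          tauto
        exact h₃ t (fun q hq => ht q (by simp [hq])) q this
    · simp only [Rates.cost]
      ring

end Takes

theorem clock_append_replicate_op (ρ : Rates) (L : List (Task P)) (p : Fin P) (k : ℕ) :
    clock ρ (L ++ List.replicate k (Task.op p)) =
      Function.update (clock ρ L) p (clock ρ L p + ρ.γ * k) := by
  induction k with
  | zero => simp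
  | succ k ih =>
    rw [List.replicate_succ', ← List.append_assoc, clock_append]
    change Function.update (β := fun _ => ℝ) _ p (clock ρ _ p + ρ.γ) = _
    rw [ih, Function.update_idem, Function.update_self]
    congr 1
    push_cast
    ring

theorem Takes.onProc {σ : Type} {ρ : Rates} {S : List (Fin P)} {p : Fin P} {x : Counted σ} {a : ℝ}
    (hp : p ∈ S) (h : (x.ops : ℝ) ≤ a) : Takes ρ (onProc p x) S a 0 0 (fun v => v = x.val) := by
  have h₀ : (0 : ℝ) ≤ a := le_trans (by positivity) h
  refine Takes.frame (S₁ := [p]) (fun L => ⟨rfl, fun q hq => ?_, fun t ht q hq => ?_⟩)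
    (by simpa using hp) h₀ le_rfl le_rfl
  · change clock ρ (L ++ List.replicate x.ops (Task.op p)) q = _
    rw [clock_append_replicate_op, Function.update_of_ne (by simpa using hq)]
  · change clock ρ (L ++ List.replicate x.ops (Task.op p)) q ≤ _
    obtain rfl : q = p := by simpa using hq
    rw [clock_append_replicate_op, Function.update_self]
    have := mul_le_mul_of_nonneg_left h ρ.γ_nonneg
    have := ht q hq
    simp only [Rates.cost]
    linarith

theorem clock_append_send (ρ : Rates) (L : List (Task P)) (p q : Fin P) (w : ℕ) :
    clock ρ (L ++ [Task.send p q w]) =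
      Function.update (clock ρ L) p (clock ρ L p + ρ.cost 0 w 1) := by
  rw [clock_append]
  change Function.update (β := fun _ => ℝ) _ p (clock ρ L p + (ρ.α + w * ρ.β)) = _
  congr 2
  simp only [Rates.cost]
  ring

theorem clock_append_recv (ρ : Rates) (L : List (Task P)) (p q : Fin P) (w i : ℕ) :
    clock ρ (L ++ [Task.recv q p w i]) =
      Function.update (clock ρ L) q (max (clock ρ L q) (finish ρ L i) + ρ.cost 0 w 1) := by
  rw [clock_append]
  change Function.update (β := fun _ => ℝ) _ q (max (clock ρ L q) (finish ρ L i) + (ρ.α + w * ρ.β)) = _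
  congr 2
  simp only [Rates.cost]
  ring

/-- A message of at most `w` words. -/
theorem Takes.transfer {σ : Type} {ρ : Rates} {S : List (Fin P)} {p q : Fin P}
    {bs : List (List ℂ)} {w a b c : ℝ} {f : List (List ℂ) → Machine P σ} {post : σ → Prop}
    (hp : p ∈ S) (hq : q ∈ S) (hw : (bs.flatten.length : ℝ) ≤ w)
    (hf : Takes ρ (f bs) S a (b - 2 * w) (c - 2) post) :
    Takes ρ (do let x ← send p q bs; let bs' ← recv x; f bs') S a b c post := by
  have key : Takes ρ (do let x ← send p q bs; recv x) S 0 (2 * w) 2 (fun v => v = bs) := by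
    intro L
    set L₁ := L ++ [Task.send p q bs.flatten.length] with hL₁
    have hrun : (do let x ← send p q bs; recv x : Machine P _).run L =
      (bs, L₁ ++ [Task.recv q p bs.flatten.length L.length]) := rfl
    rw [hrun]
    have hd : ρ.cost 0 bs.flatten.length 1 ≤ ρ.cost 0 w 1 := ρ.cost_mono le_rfl hw le_rfl
    have hd₀ : 0 ≤ ρ.cost 0 bs.flatten.length 1 :=
      ρ.cost_nonneg le_rfl (by positivity) zero_le_one
    -- The sending and the receiving lie one after the other on a path, so a message is paid for
    -- twice.
    have h2 : ρ.cost 0 (2 * w) 2 = 2 * ρ.cost 0 w 1 := by simp only [Rates.cost]; ring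
    have hfin : finish ρ L₁ L.length = clock ρ L₁ p := by
      rw [finish_append_length, clock_append]
      exact (Function.update_self p _ (clock ρ L)).symm
    refine ⟨rfl, fun r hr => ?_, fun t ht => ?_⟩
    · rw [clock_append_recv, Function.update_of_ne (by rintro rfl; exact hr hq),
        clock_append_send, Function.update_of_ne (by rintro rfl; exact hr hp)]
    · have h₁ : ∀ r ∈ S, clock ρ L₁ r ≤ t + ρ.cost 0 w 1 := by
        intro r hr
        rw [hL₁, clock_append_send]
        by_cases h : r = p
        · subst h
          rw [Function.update_self]
          linarith [ht r hr]
        · rw [Function.update_of_ne h]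
          linarith [ht r hr]
      intro r hr
      rw [clock_append_recv, hfin]
      by_cases h : r = q
      · subst h
        rw [Function.update_self]
        have := max_le (h₁ r hr) (h₁ p hp)
        linarith
      · rw [Function.update_of_ne h]
        linarith [h₁ r hr]
  have := Takes.bind (f := f) (post' := post) (a := a) (b := b) (c := c) key
    (by rintro v rfl; simpa using hf)
  rwa [bind_assoc] at this

theorem Takes.onEach {ρ : Rates} {f : Fin P → Counted Mat} {a : ℝ} (ha : 0 ≤ a)
    (ps : List (Fin P)) (hn : ps.Nodup) (h : ∀ p ∈ ps, ((f p).ops : ℝ) ≤ a) :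
    Takes ρ (onEach f ps) ps a 0 0 (fun _ => True) := by
  induction ps with
  | nil => exact Takes.pure' trivial ha le_rfl le_rfl
  | cons p ps ih =>
    rw [List.nodup_cons] at hn
    refine Takes.par (S₁ := [p]) (S₂ := ps) (a₁ := a) (b₁ := 0) (c₁ := 0)
      (by simpa using hn.1) (Takes.onProc (by simp) (h p (by simp)))
      (fun _ _ => ih hn.2 fun q hq => h q (by simp [hq])) fun _ _ _ _ => ?_
    exact Takes.pure' trivial (by simp) (by simp) (by simp)

/-! ### Exchanges -/

/-- Sends never wait, so a processor is delayed only by its own sends, which `count` counts. The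
clauses on `stamp` and `finish` are what the later receives need to bound their waiting. -/
theorem sendAll_spec {ρ : Rates} {S : List (Fin P)} {w T : ℝ}
    (xs : List (Fin P × Fin P × List (List ℂ))) (hS : ∀ x ∈ xs, x.1 ∈ S)
    (hw : ∀ x ∈ xs, (x.2.2.flatten.length : ℝ) ≤ w) (L : List (Task P))
    (hT : ∀ p ∈ S, clock ρ L p + (xs.map Prod.fst).count p * ρ.cost 0 w 1 ≤ T) :
    (∀ p ∈ S, clock ρ ((sendAll xs).run L).2 p ≤ T) ∧
    (∀ p ∉ S, clock ρ ((sendAll xs).run L).2 p = clock ρ L p) ∧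
    (∀ i < L.length, finish ρ ((sendAll xs).run L).2 i = finish ρ L i) ∧
    L.length ≤ ((sendAll xs).run L).2.length ∧
    (((sendAll xs).run L).1.map fun y => (y.src, y.dst, y.blocks)) = xs ∧
    ∀ y ∈ ((sendAll xs).run L).1, y.stamp < ((sendAll xs).run L).2.length ∧
      finish ρ ((sendAll xs).run L).2 y.stamp ≤ T := by
  induction xs generalizing L with
  | nil => exact ⟨fun p hp => le_trans (by simp; exact le_rfl) (hT p hp), fun _ _ => rfl, fun _ _ => rfl, le_rfl, rfl,
      fun _ h => by cases h⟩
  | cons x xs ih =>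
    obtain ⟨p, q, bs⟩ := x
    have hpS : p ∈ S := hS _ (List.mem_cons_self ..)
    have hwp : (bs.flatten.length : ℝ) ≤ w := hw _ (List.mem_cons_self ..)
    set L₁ := L ++ [Task.send p q bs.flatten.length] with hL₁
    have hlen : L₁.length = L.length + 1 := by simp [hL₁]
    have hd : ρ.cost 0 bs.flatten.length 1 ≤ ρ.cost 0 w 1 := ρ.cost_mono le_rfl hwp le_rfl
    have hd₀ : 0 ≤ ρ.cost 0 w 1 :=
      ρ.cost_nonneg le_rfl (le_trans (by positivity) hwp) zero_le_one
    have hT₁ : ∀ r ∈ S, clock ρ L₁ r + (xs.map Prod.fst).count r * ρ.cost 0 w 1 ≤ T := by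
      intro r hr
      have := hT r hr
      rw [hL₁, clock_append_send]
      by_cases h : r = p
      · subst h
        rw [Function.update_self]
        simp only [List.map_cons, List.count_cons_self] at this
        push_cast at this
        linarith
      · rw [Function.update_of_ne h]
        rwa [List.map_cons, List.count_cons_of_ne (Ne.symm h)] at this
    obtain ⟨h₁, h₂, h₃, h₄, h₅, h₆⟩ := ih (fun x hx => hS x (List.mem_cons_of_mem _ hx))
      (fun x hx => hw x (List.mem_cons_of_mem _ hx)) L₁ hT₁
    have hrun : (sendAll ((p, q, bs) :: xs)).run L =
      (⟨p, q, bs, L.length⟩ :: ((sendAll xs).run L₁).1, ((sendAll xs).run L₁).2) := rfl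
    rw [hrun]
    refine ⟨h₁, fun r hr => ?_, fun i hi => ?_, by dsimp only; omega, ?_, ?_⟩
    · rw [h₂ r hr, clock_append_send, Function.update_of_ne (by rintro rfl; exact hr hpS)]
    · rw [h₃ i (by omega), finish_append_of_lt _ _ _ hi]
    · simp [h₅]
    · intro y hy
      rcases List.mem_cons.1 hy with rfl | hy
      · dsimp only
        refine ⟨by omega, ?_⟩
        rw [h₃ _ (by omega)]
        have e : finish ρ L₁ L.length = clock ρ L₁ p := by
          rw [finish_append_length, clock_append]
          exact (Function.update_self p _ (clock ρ L)).symm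
        rw [e]
        have := hT₁ p hpS
        have : 0 ≤ ((xs.map Prod.fst).count p : ℝ) * ρ.cost 0 w 1 := by positivity
        linarith
      · exact h₆ y hy

/-- All matching sends are finished by `T₀`. Measuring progress by the maximum of the clock and `T₀`
charges the waiting only once; each receive then raises this maximum by at most one message. -/
theorem recvAll_spec {ρ : Rates} {S : List (Fin P)} {w T T₀ : ℝ}
    (ys : List (Msg P)) (hS : ∀ y ∈ ys, y.dst ∈ S)
    (hw : ∀ y ∈ ys, (y.blocks.flatten.length : ℝ) ≤ w) (L : List (Task P))
    (hst : ∀ y ∈ ys, y.stamp < L.length ∧ finish ρ L y.stamp ≤ T₀)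
    (hT : ∀ p ∈ S, max (clock ρ L p) T₀ + (ys.map Msg.dst).count p * ρ.cost 0 w 1 ≤ T) :
    (∀ p ∈ S, clock ρ ((recvAll ys).run L).2 p ≤ T) ∧
    (∀ p ∉ S, clock ρ ((recvAll ys).run L).2 p = clock ρ L p) ∧
    (∀ i < L.length, finish ρ ((recvAll ys).run L).2 i = finish ρ L i) ∧
    L.length ≤ ((recvAll ys).run L).2.length ∧
    ((recvAll ys).run L).1 = ys.map fun y => (y.dst, y.blocks) := by
  induction ys generalizing L with
  | nil => exact ⟨fun p hp => le_trans (by simp; exact Or.inl le_rfl) (hT p hp), fun _ _ => rfl, fun _ _ => rfl, le_rfl,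
      rfl⟩
  | cons y ys ih =>
    have hq : y.dst ∈ S := hS _ (List.mem_cons_self ..)
    have hwp := hw _ (List.mem_cons_self ..)
    set L₁ := L ++ [Task.recv y.dst y.src y.blocks.flatten.length y.stamp] with hL₁
    have hlen : L₁.length = L.length + 1 := by simp [hL₁]
    have hd : ρ.cost 0 y.blocks.flatten.length 1 ≤ ρ.cost 0 w 1 := ρ.cost_mono le_rfl hwp le_rfl
    have hd₀ : 0 ≤ ρ.cost 0 w 1 :=
      ρ.cost_nonneg le_rfl (le_trans (by positivity) hwp) zero_le_one
    have hT₁ : ∀ r ∈ S, max (clock ρ L₁ r) T₀ + (ys.map Msg.dst).count r * ρ.cost 0 w 1 ≤ T := by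
      intro r hr
      have := hT r hr
      rw [hL₁, clock_append_recv]
      by_cases h : r = y.dst
      · subst h
        rw [Function.update_self]
        simp only [List.map_cons, List.count_cons_self] at this
        push_cast at this
        have h1 := (hst y (List.mem_cons_self ..)).2
        have h2 : max (max (clock ρ L y.dst) (finish ρ L y.stamp) +
            ρ.cost 0 y.blocks.flatten.length 1) T₀ ≤
            max (clock ρ L y.dst) T₀ + ρ.cost 0 w 1 := by
          refine max_le (add_le_add (max_le_max le_rfl h1) hd) ?_
          linarith [le_max_right (clock ρ L y.dst) T₀]
        linarith
      · rw [Function.update_of_ne h]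
        rwa [List.map_cons, List.count_cons_of_ne (Ne.symm h)] at this
    obtain ⟨h₁, h₂, h₃, h₄, h₅⟩ := ih (fun x hx => hS x (List.mem_cons_of_mem _ hx))
      (fun x hx => hw x (List.mem_cons_of_mem _ hx)) L₁ (fun z hz => by
        have := hst z (List.mem_cons_of_mem _ hz)
        rw [hL₁, finish_append_of_lt _ _ _ this.1]
        exact ⟨by rw [← hL₁]; omega, this.2⟩) hT₁
    have hrun : (recvAll (y :: ys)).run L =
      ((y.dst, y.blocks) :: ((recvAll ys).run L₁).1, ((recvAll ys).run L₁).2) := rfl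
    rw [hrun]
    refine ⟨h₁, fun r hr => ?_, fun i hi => ?_, by dsimp only; omega, by simp [h₅]⟩
    · rw [h₂ r hr, clock_append_recv, Function.update_of_ne (by rintro rfl; exact hr hq)]
    · rw [h₃ i (by omega), finish_append_of_lt _ _ _ hi]

/-- Two lists of messages of at most `w` words are sent, then received; each processor sends and
receives at most two messages of each list. -/
theorem Takes.exchange {σ : Type} {ρ : Rates} {S : List (Fin P)}
    {xs ys : List (Fin P × Fin P × List (List ℂ))} {w a b c : ℝ} (hw₀ : 0 ≤ w)
    {f : List (Fin P × List (List ℂ)) → List (Fin P × List (List ℂ)) → Machine P σ}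
    {post : σ → Prop}
    (hS : ∀ x ∈ xs ++ ys, x.1 ∈ S ∧ x.2.1 ∈ S)
    (hw : ∀ x ∈ xs ++ ys, (x.2.2.flatten.length : ℝ) ≤ w)
    (hx₁ : ∀ p, (xs.map Prod.fst).count p ≤ 2) (hy₁ : ∀ p, (ys.map Prod.fst).count p ≤ 2)
    (hx₂ : ∀ p, (xs.map fun x => x.2.1).count p ≤ 2)
    (hy₂ : ∀ p, (ys.map fun x => x.2.1).count p ≤ 2)
    (hf : Takes ρ (f (xs.map Prod.snd) (ys.map Prod.snd)) S a (b - 8 * w) (c - 8) post) :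
    Takes ρ (do
      let toR ← sendAll xs
      let toL ← sendAll ys
      let inR ← recvAll toR
      let inL ← recvAll toL
      f inR inL) S a b c post := by
  have key : Takes ρ (do
      let toR ← sendAll xs
      let toL ← sendAll ys
      let inR ← recvAll toR
      let inL ← recvAll toL
      pure (inR, inL)) S 0 (8 * w) 8 (fun v => v = (xs.map Prod.snd, ys.map Prod.snd)) := by
    intro L
    have hd₀ : 0 ≤ ρ.cost 0 w 1 := ρ.cost_nonneg le_rfl hw₀ zero_le_one
    have h8 : ρ.cost 0 (8 * w) 8 = 8 * ρ.cost 0 w 1 := by simp only [Rates.cost]; ring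
    have two : ∀ {k : ℕ}, k ≤ 2 → (k : ℝ) * ρ.cost 0 w 1 ≤ 2 * ρ.cost 0 w 1 := fun h =>
      mul_le_mul_of_nonneg_right (by exact_mod_cast h) hd₀
    have main : ∀ t, (∀ p ∈ S, clock ρ L p ≤ t) → _ := fun t ht => by
      -- There are four phases, two of sends and two of receives, and each costs a processor at most
      -- two messages; the bounds on the clocks are `t` plus 2, 4, 6 and 8 messages.
      have A := sendAll_spec (ρ := ρ) (S := S) (w := w) (T := t + 2 * ρ.cost 0 w 1) xs
        (fun x hx => (hS x (by simp [hx])).1) (fun x hx => hw x (by simp [hx])) L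
        (fun p hp => add_le_add (ht p hp) (two (hx₁ p)))
      set A₁ := ((sendAll xs).run L).1 with hA₁
      set A₂ := ((sendAll xs).run L).2 with hA₂
      obtain ⟨a₁, a₂, a₃, a₄, a₅, a₆⟩ := A
      have B := sendAll_spec (ρ := ρ) (S := S) (w := w) (T := t + 4 * ρ.cost 0 w 1) ys
        (fun x hx => (hS x (by simp [hx])).1) (fun x hx => hw x (by simp [hx])) A₂
        (fun p hp => by linarith [a₁ p hp, two (hy₁ p)])
      set B₁ := ((sendAll ys).run A₂).1 with hB₁
      set B₂ := ((sendAll ys).run A₂).2 with hB₂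
      obtain ⟨b₁, b₂, b₃, b₄, b₅, b₆⟩ := B
      have hA : ∀ y ∈ A₁, (y.src, y.dst, y.blocks) ∈ xs := fun y hy => by
        rw [← a₅]; exact List.mem_map_of_mem hy
      have hB : ∀ y ∈ B₁, (y.src, y.dst, y.blocks) ∈ ys := fun y hy => by
        rw [← b₅]; exact List.mem_map_of_mem hy
      have hAd : A₁.map Msg.dst = xs.map fun x => x.2.1 := by rw [← a₅]; simp
      have hBd : B₁.map Msg.dst = ys.map fun x => x.2.1 := by rw [← b₅]; simp
      have C := recvAll_spec (ρ := ρ) (S := S) (w := w) (T₀ := t + 4 * ρ.cost 0 w 1)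
        (T := t + 6 * ρ.cost 0 w 1) A₁
        (fun y hy => (hS _ (List.mem_append_left _ (hA y hy))).2)
        (fun y hy => hw _ (List.mem_append_left _ (hA y hy))) B₂
        (fun y hy => ⟨(a₆ y hy).1.trans_le b₄, by
          rw [b₃ _ (a₆ y hy).1]; linarith [(a₆ y hy).2]⟩)
        (fun p hp => by
          have := max_le (b₁ p hp) le_rfl
          rw [hAd]
          linarith [two (hx₂ p)])
      set C₁ := ((recvAll A₁).run B₂).1 with hC₁
      set C₂ := ((recvAll A₁).run B₂).2 with hC₂
      obtain ⟨c₁, c₂, c₃, c₄, c₅⟩ := C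
      have D := recvAll_spec (ρ := ρ) (S := S) (w := w) (T₀ := t + 6 * ρ.cost 0 w 1)
        (T := t + 8 * ρ.cost 0 w 1) B₁
        (fun y hy => (hS _ (List.mem_append_right _ (hB y hy))).2)
        (fun y hy => hw _ (List.mem_append_right _ (hB y hy))) C₂
        (fun y hy => ⟨(b₆ y hy).1.trans_le c₄, by
          rw [c₃ _ (b₆ y hy).1]; linarith [(b₆ y hy).2]⟩)
        (fun p hp => by
          have := max_le (c₁ p hp) le_rfl
          rw [hBd]
          linarith [two (hy₂ p)])
      obtain ⟨d₁, d₂, d₃, d₄, d₅⟩ := D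
      have hv : (C₁, ((recvAll B₁).run C₂).1) = (xs.map Prod.snd, ys.map Prod.snd) := by
        rw [c₅, d₅, ← a₅, ← b₅]; simp
      exact (⟨hv, fun p hp => (d₂ p hp).trans ((c₂ p hp).trans ((b₂ p hp).trans (a₂ p hp))),
        fun p hp => (d₁ p hp).trans (by rw [h8])⟩ :
        (C₁, ((recvAll B₁).run C₂).1) = (xs.map Prod.snd, ys.map Prod.snd) ∧
        (∀ p ∉ S, clock ρ ((recvAll B₁).run C₂).2 p = clock ρ L p) ∧
        ∀ p ∈ S, clock ρ ((recvAll B₁).run C₂).2 p ≤ t + ρ.cost 0 (8 * w) 8)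
    -- The claims that do not mention `t` were derived under some bound on the clocks; one exists
    -- because there are finitely many processors.
    obtain ⟨t, ht⟩ : ∃ t, ∀ p ∈ S, clock ρ L p ≤ t := by
      obtain ⟨t, ht⟩ := Set.Finite.bddAbove (Set.finite_range (clock ρ L))
      exact ⟨t, fun p _ => ht ⟨p, rfl⟩⟩
    exact ⟨(main t ht).1, (main t ht).2.1, fun t ht => (main t ht).2.2⟩
  have := Takes.bind (f := fun v => f v.1 v.2) (post' := post) (a := a) (b := b) (c := c) key
    (by rintro v rfl; simpa using hf)
  simpa only [bind_assoc, pure_bind] using this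

/-! ## Operation counts of local computations -/

namespace Counted

theorem ops_bind {σ τ : Type} (x : Counted σ) (f : σ → Counted τ) :
    (x >>= f).ops = x.ops + (f x.val).ops := rfl

theorem ops_pure {σ : Type} (v : σ) : (pure v : Counted σ).ops = 0 := rfl

theorem val_bind {σ τ : Type} (x : Counted σ) (f : σ → Counted τ) :
    (x >>= f).val = (f x.val).val := rfl

theorem ops_sgn (z : ℂ) : (sgn z).ops ≤ 4 := by
  unfold sgn
  split
  · simp [ops_pure]
  · simp [ops_bind, conj, mul, sqrt, div]

theorem ops_table_le {I J N : ℕ} {f : ℕ → ℕ → Counted ℂ}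
    (h : ∀ i < I, ∀ j < J, (f i j).ops ≤ N) : (table I J f).ops ≤ I * J * N := by
  have : ∀ i ∈ Finset.range I, ∑ j ∈ Finset.range J, (f i j).ops ≤ J * N := fun i hi => by
    refine (Finset.sum_le_card_nsmul _ _ N fun j hj => ?_).trans (by simp)
    exact h i (Finset.mem_range.1 hi) j (Finset.mem_range.1 hj)
  refine (Finset.sum_le_card_nsmul _ _ _ this).trans (by simp [mul_assoc])

theorem ops_dot (f g : ℕ → ℂ) (k : ℕ) : (dot f g k).ops = 2 * k := by
  induction k with
  | zero => rfl
  | succ k ih =>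
    simp only [dot, ops_bind, ih, mul, add]
    ring

theorem ops_matMul_le (I J K : ℕ) (A B : Mat) : (matMul I J K A B).ops ≤ I * J * (2 * K) :=
  ops_table_le fun _ _ _ _ => (ops_dot _ _ _).le

theorem ops_adjoint_le (I J : ℕ) (A : Mat) : (adjoint I J A).ops ≤ I * J := by
  refine (ops_table_le (N := 1) fun _ _ _ _ => le_rfl).trans (le_of_eq (by ring))

theorem ops_matSub_le (I J : ℕ) (A B : Mat) : (matSub I J A B).ops ≤ I * J := by
  refine (ops_table_le (N := 1) fun _ _ _ _ => le_rfl).trans (le_of_eq (by ring))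

theorem le_mul_sq (μ ν : ℕ) : μ * ν ≤ μ * ν ^ 2 := by
  gcongr
  exact Nat.le_self_pow two_ne_zero ν

theorem pow_three_le {μ ν : ℕ} (h : ν ≤ μ) : ν ^ 3 ≤ μ * ν ^ 2 := by
  calc ν ^ 3 = ν * ν ^ 2 := by ring
    _ ≤ μ * ν ^ 2 := by gcongr

/-- The adjoint and the subtraction count `1` each and the three products `2` each, in units of
`μν²`; the hypothesis is needed for the product of order `ν³`. -/
theorem ops_applyQ_le {μ ν : ℕ} (h : ν ≤ μ) (V T X : Mat) :
    (applyQ μ ν V T X).ops ≤ 8 * (μ * ν ^ 2) := by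
  simp only [applyQ, ops_bind]
  have h₁ := ops_adjoint_le μ ν V
  have h₂ := ops_matMul_le ν ν μ (adjoint μ ν V).val X
  have h₃ := ops_matMul_le ν ν ν T (matMul ν ν μ (adjoint μ ν V).val X).val
  have h₄ := ops_matMul_le μ ν ν V (matMul ν ν ν T (matMul ν ν μ (adjoint μ ν V).val X).val).val
  have h₅ := ops_matSub_le μ ν X
    (matMul μ ν ν V (matMul ν ν ν T (matMul ν ν μ (adjoint μ ν V).val X).val).val).val
  have := le_mul_sq μ ν
  have := pow_three_le h
  have e₂ : ν * ν * (2 * μ) = 2 * (μ * ν ^ 2) := by ring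
  have e₃ : ν * ν * (2 * ν) = 2 * ν ^ 3 := by ring
  have e₄ : μ * ν * (2 * ν) = 2 * (μ * ν ^ 2) := by ring
  omega

theorem ops_solveUpper_le (μ : ℕ) (U W : Mat) (j : ℕ) :
    (solveUpper μ U W j).ops ≤ 2 * (μ * j ^ 2) := by
  induction j with
  | zero => simp [solveUpper, ops_pure]
  | succ j ih =>
    simp only [solveUpper, ops_bind, ops_pure]
    have := ops_table_le (I := μ) (J := 1) (N := 2 * j + 2)
      (f := fun i _ => do
        let s ← dot (fun l => (solveUpper μ U W j).val i l) (fun l => U l j) j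
        let d ← sub (W i j) s
        div d (U j j))
      (fun i _ l _ => by simp [ops_bind, ops_dot, sub, div])
    have e : 2 * (μ * (j + 1) ^ 2) = 2 * (μ * j ^ 2) + (μ * 1 * (2 * j + 2)) + μ * (2 * j) := by
      ring
    omega

theorem ops_signedLU_le (n : ℕ) (X : Mat) (j : ℕ) :
    (signedLU n X j).ops ≤ j * (5 + n + 2 * n ^ 2) := by
  induction j with
  | zero => simp [signedLU, ops_pure]
  | succ j ih =>
    obtain ⟨⟨⟨Y, S⟩, k⟩, hk⟩ : ∃ x, signedLU n X j = x := ⟨_, rfl⟩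
    have hk' : k ≤ j * (5 + n + 2 * n ^ 2) := by rw [hk] at ih; exact ih
    simp only [signedLU, ops_bind, ops_pure, hk]
    have h₁ := ops_sgn (Y j j)
    have h₂ := ops_table_le (I := n) (J := 1) (N := 1)
      (f := fun i _ => if j < i then div (Y i j) (add (Y j j) (sgn (Y j j)).val).val else pure 0)
      (fun i _ l _ => by split <;> simp [div, ops_pure])
    have h₃ := ops_table_le (I := n) (J := n) (N := 2)
      (f := fun i k => if j < i ∧ j < k then do
          let t ← mul ((table n 1 fun i _ => if j < i then
            div (Y i j) (add (Y j j) (sgn (Y j j)).val).val else pure 0).val i 0) (Y j k)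
          sub (Y i k) t
        else pure (Y i k))
      (fun i _ l _ => by split <;> simp [ops_bind, mul, sub, ops_pure])
    have e : (j + 1) * (5 + n + 2 * n ^ 2) = j * (5 + n + 2 * n ^ 2) + 5 + n * 1 * 1 + n * n * 2 := by
      ring
    have h₄ : (add (Y j j) (sgn (Y j j)).val).ops = 1 := rfl
    omega

theorem addBlock_le (x y : List ℂ) :
    (addBlock x y).ops ≤ x.length ∧ (addBlock x y).val.length ≤ x.length := by
  induction x generalizing y with
  | nil => simp [addBlock, pure]
  | cons a x ih =>
    cases y with
    | nil => simp [addBlock, pure]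
    | cons b y =>
      have := ih y
      simp only [addBlock, ops_bind, val_bind, ops_pure, List.length_cons]
      have h₁ : (add a b).ops = 1 := rfl
      have h₂ : (pure ((add a b).val :: (addBlock x y).val) : Counted (List ℂ)).val =
        (add a b).val :: (addBlock x y).val := rfl
      rw [h₂, List.length_cons]
      omega

/-- The bound on lengths is kept because the sums are sent on in later rounds of the reduce-scatter.
-/
theorem addBlocks_le {h : ℕ} (xs ys : List (List ℂ)) (hx : ∀ x ∈ xs, x.length ≤ h) :
    (addBlocks xs ys).ops ≤ xs.length * h ∧ ∀ z ∈ (addBlocks xs ys).val, z.length ≤ h := by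
  induction xs generalizing ys with
  | nil => simp [addBlocks, pure]
  | cons x xs ih =>
    cases ys with
    | nil => simp [addBlocks, pure]
    | cons y ys =>
      have h₁ := ih ys fun z hz => hx z (List.mem_cons_of_mem _ hz)
      have h₂ := addBlock_le x y
      have h₃ := hx x (List.mem_cons_self ..)
      simp only [addBlocks, ops_bind, val_bind, ops_pure, List.length_cons]
      have h₄ : (pure ((addBlock x y).val :: (addBlocks xs ys).val) :
        Counted (List (List ℂ))).val = (addBlock x y).val :: (addBlocks xs ys).val := rfl
      rw [h₄]
      refine ⟨by rw [add_mul]; omega, fun z hz => ?_⟩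
      rcases List.mem_cons.1 hz with rfl | hz
      · exact h₂.2.trans h₃
      · exact h₁.2 z hz

end Counted

/-! ## Trees of processors -/

namespace ProcTree

variable {P : ℕ} {σ : Type}

/-- The number of edges on a longest path from the root. -/
def depth : ProcTree P σ → ℕ
  | leaf _ _ => 0
  | node _ l r => max l.depth r.depth + 1

/-- The largest sum, over a path from the root, of the sizes of the larger parts into which the
sets of processors are split. -/
def volume : ProcTree P σ → ℕ
  | leaf _ _ => 0
  | node _ l r => max l.volume r.volume + max l.leaves.length r.leaves.length

/-- The tree without its items. -/
def shape : ProcTree P σ → ProcTree P Unit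
  | leaf p _ => leaf p ()
  | node _ l r => node () l.shape r.shape

theorem leaves_shape (t : ProcTree P σ) : t.shape.leaves = t.leaves := by
  induction t with
  | leaf p x => rfl
  | node x l r ihl ihr => simp only [shape, leaves, ihl, ihr]

theorem depth_shape (t : ProcTree P σ) : t.shape.depth = t.depth := by
  induction t with
  | leaf p x => rfl
  | node x l r ihl ihr => simp only [shape, depth, ihl, ihr]

theorem root_mem_leaves (t : ProcTree P σ) : t.root ∈ t.leaves := by
  induction t with
  | leaf p x => simp [root, leaves]
  | node x l r ihl ihr => simp [root, leaves, ihl]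

/-- Each split of `s > 1` processors leaves parts of at most `⌈s/2⌉`, so part sizes along a branch
decrease geometrically; with `2(s - 1)` as the bound the induction comes down to `3⌈s/2⌉ ≤ 2s`. -/
theorem build_spec (p : Fin P) (ps : List (Fin P)) :
    (build p ps).leaves = p :: ps ∧ (build p ps).root = p ∧
      (build p ps).volume ≤ 2 * ps.length ∧
      ∀ k, ps.length + 1 ≤ 2 ^ k → (build p ps).depth ≤ k := by
  induction hN : ps.length using Nat.strong_induction_on generalizing p ps with
  | _ N ih =>
    subst hN
    rw [build]
    split
    next h =>
      have hl := congrArg List.length h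
      simp at hl
      have : ps = [] := List.length_eq_zero_iff.1 (by omega)
      subst this
      simp [leaves, root, volume, depth]
    next q qs h =>
      have hl := congrArg List.length h
      simp at hl
      set e := (ps.length + 2) / 2 - 1 with he
      have hte : (ps.take e).length = e := by simp; omega
      obtain ⟨a₁, a₂, a₃, a₄⟩ := ih (ps.take e).length (by omega) p (ps.take e) rfl
      obtain ⟨b₁, b₂, b₃, b₄⟩ := ih qs.length (by omega) q qs rfl
      refine ⟨?_, a₂, ?_, fun k hk => ?_⟩
      · simp only [leaves, a₁, b₁, ← h]
        simp
      · simp only [volume, a₁, b₁, List.length_cons]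
        omega
      · simp only [depth]
        cases k with
        | zero => rw [pow_zero] at hk; omega
        | succ k =>
          rw [pow_succ] at hk
          have h₁ : (ps.take e).length + 1 ≤ 2 ^ k := by
            generalize 2 ^ k = x at *
            omega
          have h₂ : qs.length + 1 ≤ 2 ^ k := by
            generalize 2 ^ k = x at *
            omega
          exact Nat.succ_le_succ (max_le (a₄ k h₁) (b₄ k h₂))

end ProcTree

/-! ## Collective communication -/

theorem length_flatten_le {σ : Type} {h : ℕ} (bs : List (List σ)) (hb : ∀ x ∈ bs, x.length ≤ h) :
    bs.flatten.length ≤ bs.length * h := by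
  induction bs with
  | nil => simp
  | cons x bs ih =>
    have := ih fun y hy => hb y (List.mem_cons_of_mem _ hy)
    have := hb x (List.mem_cons_self ..)
    simp only [List.flatten_cons, List.length_append, List.length_cons, add_mul]
    omega

theorem length_pick_le {h : ℕ} (ds : List (Fin P)) (bs : List (List ℂ))
    (hb : ∀ x ∈ bs, x.length ≤ h) (d : Fin P) : (pick ds bs d).length ≤ h := by
  unfold pick
  by_cases hd : ds.idxOf d < bs.length
  · rw [List.getD_eq_getElem _ _ hd]
    exact hb _ (List.getElem_mem _)
  · rw [List.getD_eq_default _ _ (not_lt.1 hd)]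
    simp

theorem length_flatten_map_le {h : ℕ} (ds : List (Fin P)) (D : Fin P → List ℂ)
    (hD : ∀ p, (D p).length ≤ h) {M : ℕ} (hM : ds.length ≤ M) :
    ((ds.map D).flatten.length : ℝ) ≤ M * h := by
  have := length_flatten_le (h := h) (ds.map D) (by simpa using fun p _ => hD p)
  rw [List.length_map] at this
  exact_mod_cast this.trans (Nat.mul_le_mul_right h hM)

open ProcTree

theorem nodup_node {σ : Type} {x : σ} {l r : ProcTree P σ} (h : (node x l r).leaves.Nodup) :
    l.leaves.Nodup ∧ r.leaves.Nodup ∧ ∀ p ∈ l.leaves, p ∉ r.leaves := by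
  obtain ⟨h₁, h₂, h₃⟩ := List.nodup_append.1 h
  exact ⟨h₁, h₂, fun p hp hp' => h₃ p hp p hp' rfl⟩

/-- A vertex sends one block per processor of its right part, and then both parts proceed in
parallel. Hence only the worst branch counts, which is what `volume` and `depth` measure. -/
theorem Takes.scatter (ρ : Rates) {h : ℕ} (t : ProcTree P Unit) (ht : t.leaves.Nodup)
    (D : Fin P → List ℂ) (hD : ∀ p, (D p).length ≤ h) :
    Takes ρ (scatter t D) t.leaves 0 (2 * h * t.volume) (2 * t.depth)
      (fun X => ∀ p, (X p).length ≤ h) := by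
  induction t generalizing D with
  | leaf p x => exact Takes.pure' hD le_rfl (by positivity) (by positivity)
  | node x l r ihl ihr =>
    obtain ⟨h₁, h₂, h₃⟩ := nodup_node ht
    change Takes ρ _ (l.leaves ++ r.leaves) _ _ _ _
    refine Takes.transfer (w := (max l.leaves.length r.leaves.length : ℕ) * h)
      (by simp [root_mem_leaves]) (by simp [root_mem_leaves])
      (length_flatten_map_le _ _ hD (le_max_right _ _)) ?_
    refine Takes.par (a₁ := 0) (b₁ := 2 * h * (max l.volume r.volume : ℕ))
      (c₁ := 2 * (max l.depth r.depth : ℕ)) (post := fun X => ∀ p, (X p).length ≤ h)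
      (post₂ := fun X => ∀ p, (X p).length ≤ h) h₃
      ((ihl h₁ D hD).mono le_rfl (by gcongr; exact le_max_left _ _)
        (by gcongr; exact le_max_left _ _) fun _ => id) (fun X hX => ?_) fun X Y hX hY => ?_
    · refine (ihr h₂ _ fun p => ?_).mono le_rfl (by gcongr; exact le_max_right _ _)
        (by gcongr; exact le_max_right _ _) fun _ => id
      exact length_pick_le _ _ (by simpa using fun p _ => hD p) p
    · refine Takes.pure' (fun p => ?_) (by simp) ?_ ?_
      · split
        · exact hY p
        · exact hX p
      · simp only [volume]
        push_cast
        linarith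
      · simp only [depth]
        push_cast
        linarith

theorem Takes.gather (ρ : Rates) {h : ℕ} (X : Fin P → List ℂ) (hX : ∀ p, (X p).length ≤ h)
    (t : ProcTree P Unit) (ht : t.leaves.Nodup) :
    Takes ρ (gather X t) t.leaves 0 (2 * h * t.volume) (2 * t.depth)
      (fun Y => ∀ p, (Y p).length ≤ h) := by
  induction t with
  | leaf p x => exact Takes.pure' (fun _ => hX p) le_rfl (by positivity) (by positivity)
  | node x l r ihl ihr =>
    obtain ⟨h₁, h₂, h₃⟩ := nodup_node ht
    refine Takes.par (S₁ := l.leaves) (S₂ := r.leaves) (a₁ := 0)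
      (b₁ := 2 * h * (max l.volume r.volume : ℕ))
      (c₁ := 2 * (max l.depth r.depth : ℕ)) (post := fun X => ∀ p, (X p).length ≤ h)
      (post₂ := fun X => ∀ p, (X p).length ≤ h) h₃
      ((ihl h₁).mono le_rfl (by gcongr; exact le_max_left _ _)
        (by gcongr; exact le_max_left _ _) fun _ => id)
      (fun A hA => (ihr h₂).mono le_rfl (by gcongr; exact le_max_right _ _)
        (by gcongr; exact le_max_right _ _) fun _ => id) fun A B hA hB => ?_
    refine Takes.transfer (w := (max l.leaves.length r.leaves.length : ℕ) * h)
      (by simp [root_mem_leaves]) (by simp [root_mem_leaves])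
      (length_flatten_map_le _ _ hB (le_max_right _ _)) ?_
    refine Takes.pure' (fun p => ?_) (by simp) ?_ ?_
    · split
      · exact length_pick_le _ _ (by simpa using fun p _ => hB p) p
      · exact hA p
    · simp only [volume]
      push_cast
      linarith
    · simp only [depth]
      push_cast
      linarith

theorem Takes.treeBroadcast (ρ : Rates) {h : ℕ} (t : ProcTree P Unit) (ht : t.leaves.Nodup)
    (x : List ℂ) (hx : x.length ≤ h) :
    Takes ρ (treeBroadcast t x) t.leaves 0 (2 * h * t.depth) (2 * t.depth) (fun _ => True) := by
  induction t generalizing x with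
  | leaf p _ => exact Takes.pure' trivial le_rfl (by positivity) (by positivity)
  | node _ l r ihl ihr =>
    obtain ⟨h₁, h₂, h₃⟩ := nodup_node ht
    change Takes ρ _ (l.leaves ++ r.leaves) _ _ _ _
    refine Takes.transfer (w := h)
      (by simp [root_mem_leaves]) (by simp [root_mem_leaves])
      (by simpa using hx) ?_
    refine Takes.par (a₁ := 0) (b₁ := 2 * h * (max l.depth r.depth : ℕ))
      (c₁ := 2 * (max l.depth r.depth : ℕ)) h₃
      ((ihl h₁ x hx).mono le_rfl (by gcongr; exact le_max_left _ _)
        (by gcongr; exact le_max_left _ _) fun _ => id)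
      (fun _ _ => (ihr h₂ _ (by simpa using hx)).mono le_rfl (by gcongr; exact le_max_right _ _)
        (by gcongr; exact le_max_right _ _) fun _ => id) fun _ _ _ _ => ?_
    refine Takes.pure' trivial (by simp) ?_ ?_ <;>
    · simp only [depth]
      push_cast
      linarith

/-! ### Pairs of processors -/

theorem count_map_fst_zip_le (ls rs : List (Fin P)) (p : Fin P) :
    ((ls.zip rs).map Prod.fst).count p ≤ ls.count p := by
  induction ls generalizing rs with
  | nil => simp
  | cons a ls ih =>
    cases rs with
    | nil => simp
    | cons b rs =>
      have := ih rs
      simp only [List.zip_cons_cons, List.map_cons, List.count_cons]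
      omega

theorem count_map_snd_zip_le (ls rs : List (Fin P)) (p : Fin P) :
    ((ls.zip rs).map Prod.snd).count p ≤ rs.count p := by
  induction ls generalizing rs with
  | nil => simp
  | cons a ls ih =>
    cases rs with
    | nil => simp
    | cons b rs =>
      have := ih rs
      simp only [List.zip_cons_cons, List.map_cons, List.count_cons]
      omega

theorem count_fst_zip_le {ls rs : List (Fin P)} (hl : ls.Nodup) (p : Fin P) :
    ((ls.zip rs).map Prod.fst).count p ≤ 2 :=
  (count_map_fst_zip_le ls rs p).trans ((List.nodup_iff_count_le_one.1 hl p).trans one_le_two)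

theorem count_snd_zip_le {ls rs : List (Fin P)} (hr : rs.Nodup) (p : Fin P) :
    ((ls.zip rs).map Prod.snd).count p ≤ 2 :=
  (count_map_snd_zip_le ls rs p).trans ((List.nodup_iff_count_le_one.1 hr p).trans one_le_two)

theorem count_fst_pairs_le {ls rs : List (Fin P)} (hl : ls.Nodup) (p : Fin P) :
    ((pairs ls rs).map Prod.fst).count p ≤ 2 := count_fst_zip_le hl p

/-- Only the last processor of `rs`, repeated to match a longer `ls`, can occur twice. This is the
reason for the bound of two messages in `Takes.exchange`. -/
theorem count_snd_pairs_le {ls rs : List (Fin P)} (hr : rs.Nodup) (p : Fin P) :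
    ((pairs ls rs).map Prod.snd).count p ≤ 2 := by
  refine (count_map_snd_zip_le ls _ p).trans ?_
  rw [List.count_append]
  have h₁ := List.nodup_iff_count_le_one.1 hr p
  have h₂ : rs.getLast?.toList.count p ≤ 1 := by
    cases rs.getLast? with
    | none => simp
    | some a => exact List.count_le_length.trans (by simp)
  omega

theorem mem_of_mem_pairs {ls rs : List (Fin P)} {e : Fin P × Fin P} (h : e ∈ pairs ls rs) :
    e.1 ∈ ls ∧ e.2 ∈ rs := by
  obtain ⟨h₁, h₂⟩ := List.of_mem_zip (a := e.1) (b := e.2) h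
  refine ⟨h₁, ?_⟩
  rcases List.mem_append.1 h₂ with h₂ | h₂
  · exact h₂
  · exact List.mem_of_getLast? (Option.mem_toList.1 h₂)

/-! ### Bidirectional exchange -/

theorem accumulate_spec {ρ : Rates} {h : ℕ} {S : List (Fin P)} (ds : List (Fin P))
    (xs : List (Fin P × List (List ℂ))) (hS : ∀ x ∈ xs, x.1 ∈ S)
    (D : Fin P → Fin P → List ℂ) (hD : ∀ p d, (D p d).length ≤ h) (L : List (Task P)) :
    (∀ p d, (((accumulate ds xs D).run L).1 p d).length ≤ h) ∧
    (∀ p ∉ S, clock ρ ((accumulate ds xs D).run L).2 p = clock ρ L p) ∧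
    ∀ t, (∀ p ∈ S, clock ρ L p + (xs.map Prod.fst).count p * ρ.cost (ds.length * h : ℕ) 0 0 ≤ t) →
      ∀ p ∈ S, clock ρ ((accumulate ds xs D).run L).2 p ≤ t := by
  induction xs generalizing D L with
  | nil => exact ⟨hD, fun _ _ => rfl, fun t ht p hp => le_trans (by simp; exact le_rfl) (ht p hp)⟩
  | cons x xs ih =>
    obtain ⟨q, bs⟩ := x
    have hq : q ∈ S := hS _ (List.mem_cons_self ..)
    obtain ⟨n₁, n₂⟩ := Counted.addBlocks_le (h := h) (ds.map (D q)) bs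
      (by simpa using fun d _ => hD q d)
    rw [List.length_map] at n₁
    set new := Counted.addBlocks (ds.map (D q)) bs with hnew
    set D' := Function.update D q fun d => if d ∈ ds then pick ds new.val d else D q d with hD'
    obtain ⟨h₁, h₂, h₃⟩ := ih (fun x hx => hS x (List.mem_cons_of_mem _ hx)) D' (fun p d => by
      by_cases hp : p = q
      · subst hp
        rw [hD', Function.update_self]
        split
        · exact length_pick_le _ _ n₂ d
        · exact hD p d
      · rw [hD', Function.update_of_ne hp]
        exact hD p d) (L ++ List.replicate new.ops (Task.op q))
    have hrun : (accumulate ds ((q, bs) :: xs) D).run L =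
      (accumulate ds xs D').run (L ++ List.replicate new.ops (Task.op q)) := rfl
    rw [hrun]
    refine ⟨h₁, fun p hp => ?_, fun t ht => h₃ t fun p hp => ?_⟩
    · rw [h₂ p hp, clock_append_replicate_op, Function.update_of_ne (by rintro rfl; exact hp hq)]
    · have := ht p hp
      rw [clock_append_replicate_op]
      by_cases hpq : p = q
      · subst hpq
        rw [Function.update_self]
        simp only [List.map_cons, List.count_cons_self] at this
        have e : ρ.γ * (new.ops : ℝ) ≤ ρ.cost (ds.length * h : ℕ) 0 0 := by
          have := mul_le_mul_of_nonneg_left (Nat.cast_le (α := ℝ).2 n₁) ρ.γ_nonneg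
          simpa [Rates.cost] using this
        push_cast at this e ⊢
        linarith
      · rw [Function.update_of_ne hpq]
        rwa [List.map_cons, List.count_cons_of_ne (Ne.symm hpq)] at this

theorem Takes.accumulate (ρ : Rates) {h M : ℕ} {S : List (Fin P)} (ds : List (Fin P))
    (hM : ds.length ≤ M) (xs : List (Fin P × List (List ℂ))) (hS : ∀ x ∈ xs, x.1 ∈ S)
    (hc : ∀ p, (xs.map Prod.fst).count p ≤ 2)
    (D : Fin P → Fin P → List ℂ) (hD : ∀ p d, (D p d).length ≤ h) :
    Takes ρ (accumulate ds xs D) S (2 * (M * h)) 0 0 (fun E => ∀ p d, (E p d).length ≤ h) := by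
  intro L
  obtain ⟨h₁, h₂, h₃⟩ := accumulate_spec (ρ := ρ) ds xs hS D hD L
  refine ⟨h₁, h₂, fun t ht => h₃ _ fun p hp => add_le_add (ht p hp) ?_⟩
  have e₁ : ρ.cost (ds.length * h : ℕ) 0 0 ≤ ρ.cost (M * h) 0 0 := by
    refine ρ.cost_mono ?_ le_rfl le_rfl
    push_cast
    gcongr
  have e₀ : 0 ≤ ρ.cost (ds.length * h : ℕ) 0 0 :=
    ρ.cost_nonneg (by positivity) le_rfl le_rfl
  have e₂ : ρ.cost (2 * (M * h)) 0 0 = 2 * ρ.cost (M * h) 0 0 := by simp only [Rates.cost]; ring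
  rw [e₂]
  exact mul_le_mul (by exact_mod_cast hc p) e₁ e₀ (by norm_num)

/-- Per vertex, with `M` the size of the larger part: one exchange of messages of `M * h` words,
then two accumulations in each of which a processor adds at most two messages; thus `8` and `4`
times `M * h`. -/
theorem Takes.reduceScatter (ρ : Rates) {h : ℕ} (t : ProcTree P Unit) (ht : t.leaves.Nodup)
    (D : Fin P → Fin P → List ℂ) (hD : ∀ p d, (D p d).length ≤ h) :
    Takes ρ (reduceScatter t D) t.leaves (4 * h * t.volume) (8 * h * t.volume) (8 * t.depth)
      (fun X => ∀ p, (X p).length ≤ h) := by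
  induction t generalizing D with
  | leaf p x => exact Takes.pure' (fun d => hD p p) (by positivity) (by positivity) (by positivity)
  | node x l r ihl ihr =>
    obtain ⟨h₁, h₂, h₃⟩ := nodup_node ht
    change Takes ρ _ (l.leaves ++ r.leaves) _ _ _ _
    set M := max l.leaves.length r.leaves.length with hM
    refine Takes.exchange (w := M * h) (by positivity) ?_ ?_ ?_ ?_ ?_ ?_ ?_
    · intro x hx
      rcases List.mem_append.1 hx with hx | hx
      · obtain ⟨e, he, rfl⟩ := List.mem_map.1 hx
        simp [mem_of_mem_pairs he]
      · obtain ⟨e, he, rfl⟩ := List.mem_map.1 hx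
        simp [List.of_mem_zip (a := e.1) (b := e.2) he]
    · intro x hx
      rcases List.mem_append.1 hx with hx | hx
      · obtain ⟨e, he, rfl⟩ := List.mem_map.1 hx
        exact length_flatten_map_le _ _ (hD _) (le_max_right _ _)
      · obtain ⟨e, he, rfl⟩ := List.mem_map.1 hx
        exact length_flatten_map_le _ _ (hD _) (le_max_left _ _)
    · intro p
      rw [List.map_map]
      exact count_fst_pairs_le h₁ p
    · intro p
      rw [List.map_map]
      exact count_snd_zip_le h₂ p
    · intro p
      rw [List.map_map]
      exact count_snd_pairs_le h₂ p
    · intro p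
      rw [List.map_map]
      exact count_fst_zip_le h₁ p
    refine Takes.bind (Takes.accumulate ρ (M := M) r.leaves (le_max_right _ _) _ ?_ ?_ D hD)
      fun D₁ hD₁ => ?_
    · intro x hx
      simp only [List.map_map, List.mem_map] at hx
      obtain ⟨e, he, rfl⟩ := hx
      simp [mem_of_mem_pairs he]
    · intro p
      simp only [List.map_map]
      exact count_snd_pairs_le h₂ p
    refine Takes.bind (Takes.accumulate ρ (M := M) l.leaves (le_max_left _ _) _ ?_ ?_ D₁ hD₁)
      fun D₂ hD₂ => ?_
    · intro x hx
      simp only [List.map_map, List.mem_map] at hx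
      obtain ⟨e, he, rfl⟩ := hx
      simp [List.of_mem_zip (a := e.1) (b := e.2) he]
    · intro p
      simp only [List.map_map]
      exact count_fst_zip_le h₁ p
    refine Takes.par (a₁ := 4 * h * (max l.volume r.volume : ℕ))
      (b₁ := 8 * h * (max l.volume r.volume : ℕ))
      (c₁ := 8 * (max l.depth r.depth : ℕ)) (post := fun X => ∀ p, (X p).length ≤ h)
      (post₂ := fun X => ∀ p, (X p).length ≤ h) h₃
      ((ihl h₁ D₂ hD₂).mono (by gcongr; exact le_max_left _ _) (by gcongr; exact le_max_left _ _)
        (by gcongr; exact le_max_left _ _) fun _ => id)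
      (fun X hX => (ihr h₂ D₂ hD₂).mono (by gcongr; exact le_max_right _ _)
        (by gcongr; exact le_max_right _ _) (by gcongr; exact le_max_right _ _) fun _ => id)
      fun X Y hX hY => ?_
    refine Takes.pure' (fun p => ?_) ?_ ?_ ?_
    · split
      · exact hY p
      · exact hX p
    · simp only [volume, ← hM]
      push_cast
      linarith
    · simp only [volume, ← hM]
      push_cast
      linarith
    · simp only [depth]
      push_cast
      linarith

theorem length_pick_lookup_le {h : ℕ} {xs : List (Fin P × List (List ℂ))}
    (hx : ∀ x ∈ xs, ∀ b ∈ x.2, b.length ≤ h) (ds : List (Fin P)) (p d : Fin P) :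
    (pick ds ((xs.lookup p).getD []) d).length ≤ h := by
  refine length_pick_le _ _ ?_ d
  cases hp : xs.lookup p with
  | none => simp
  | some bs =>
    obtain ⟨l₁, l₂, rfl, -⟩ := List.lookup_eq_some_iff.1 hp
    exact hx (p, bs) (by simp)

theorem Takes.allGather (ρ : Rates) {h : ℕ} (X : Fin P → List ℂ) (hX : ∀ p, (X p).length ≤ h)
    (t : ProcTree P Unit) (ht : t.leaves.Nodup) :
    Takes ρ (allGather X t) t.leaves 0 (8 * h * t.volume) (8 * t.depth)
      (fun Z => ∀ p d, (Z p d).length ≤ h) := by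
  induction t with
  | leaf p x => exact Takes.pure' (fun _ _ => hX p) le_rfl (by positivity) (by positivity)
  | node x l r ihl ihr =>
    obtain ⟨h₁, h₂, h₃⟩ := nodup_node ht
    set M := max l.leaves.length r.leaves.length with hM
    refine Takes.par (S₁ := l.leaves) (S₂ := r.leaves) (a₁ := 0)
      (b₁ := 8 * h * (max l.volume r.volume : ℕ))
      (c₁ := 8 * (max l.depth r.depth : ℕ)) (post := fun X => ∀ p d, (X p d).length ≤ h)
      (post₂ := fun X => ∀ p d, (X p d).length ≤ h) h₃
      ((ihl h₁).mono le_rfl (by gcongr; exact le_max_left _ _)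
        (by gcongr; exact le_max_left _ _) fun _ => id)
      (fun A hA => (ihr h₂).mono le_rfl (by gcongr; exact le_max_right _ _)
        (by gcongr; exact le_max_right _ _) fun _ => id) fun A B hA hB => ?_
    refine Takes.exchange (w := M * h) (by positivity) ?_ ?_ ?_ ?_ ?_ ?_ ?_
    · intro x hx
      rcases List.mem_append.1 hx with hx | hx
      · obtain ⟨e, he, rfl⟩ := List.mem_map.1 hx
        simp [List.of_mem_zip (a := e.1) (b := e.2) he]
      · obtain ⟨e, he, rfl⟩ := List.mem_map.1 hx
        simp [mem_of_mem_pairs he]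
    · intro x hx
      rcases List.mem_append.1 hx with hx | hx
      · obtain ⟨e, he, rfl⟩ := List.mem_map.1 hx
        exact length_flatten_map_le _ _ (hA _) (le_max_left _ _)
      · obtain ⟨e, he, rfl⟩ := List.mem_map.1 hx
        exact length_flatten_map_le _ _ (hB _) (le_max_right _ _)
    · intro p
      rw [List.map_map]
      exact count_fst_zip_le h₁ p
    · intro p
      rw [List.map_map]
      exact count_snd_pairs_le h₂ p
    · intro p
      rw [List.map_map]
      exact count_snd_zip_le h₂ p
    · intro p
      rw [List.map_map]
      exact count_fst_pairs_le h₁ p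
    refine Takes.pure' (fun p d => ?_) (by simp) ?_ ?_
    · have key₁ : ∀ x ∈ ((l.leaves.zip r.leaves).map
          fun e => (e.1, e.2, l.leaves.map (A e.1))).map Prod.snd,
          ∀ b ∈ x.2, b.length ≤ h := by
        simp only [List.map_map, List.mem_map]
        rintro x ⟨e, -, rfl⟩
        simpa using fun d _ => hA e.1 d
      have key₂ : ∀ x ∈ ((pairs l.leaves r.leaves).map
          fun e => (e.2, e.1, r.leaves.map (B e.2))).map Prod.snd,
          ∀ b ∈ x.2, b.length ≤ h := by
        simp only [List.map_map, List.mem_map]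
        rintro x ⟨e, -, rfl⟩
        simpa using fun d _ => hB e.2 d
      split
      · split
        · exact hB p d
        · exact length_pick_lookup_le key₁ _ _ _
      · split
        · exact length_pick_lookup_le key₂ _ _ _
        · exact hA p d
    · simp only [volume, ← hM]
      push_cast
      linarith
    · simp only [depth]
      push_cast
      linarith

theorem length_chunk_le (w : ℕ) (x : List ℂ) (d : Fin P) : (chunk w x d).length ≤ w ⌈/⌉ P := by
  simp [chunk]

/-- Rounding the block size up costs less than one word per block. The resulting summand `P` is the
one that the assumption `P = O(b²)` later removes. -/
theorem ceilDiv_mul_volume_le {t : ProcTree P Unit} (hv : t.volume ≤ 2 * P) (w : ℕ) :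
    ((w ⌈/⌉ P : ℕ) : ℝ) * t.volume ≤ 2 * (w + P) := by
  have h : P * (w ⌈/⌉ P) ≤ w + P := by
    rw [Nat.ceilDiv_eq_add_pred_div]
    exact (Nat.mul_div_le _ _).trans (Nat.sub_le _ _)
  have h' : (w ⌈/⌉ P) * t.volume ≤ 2 * (w + P) := by
    calc (w ⌈/⌉ P) * t.volume ≤ (w ⌈/⌉ P) * (2 * P) := by gcongr
      _ = 2 * (P * (w ⌈/⌉ P)) := by ring
      _ ≤ _ := by omega
  exact_mod_cast h'

/-- Reduce-scatter and gather contribute `8 + 2` per unit of volume and depth; block size times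
volume is at most `2(w + P)`, whence `20`. -/
theorem Takes.reduce (ρ : Rates) (t : ProcTree P Unit) (ht : t.leaves.Nodup)
    (hv : t.volume ≤ 2 * P) (w : ℕ) (X : Fin P → List ℂ) :
    Takes ρ (reduce t w X) t.leaves (8 * (w + P)) (20 * (w + P)) (10 * t.depth)
      (fun _ => True) := by
  have := ceilDiv_mul_volume_le hv w
  refine Takes.bind (Takes.reduceScatter ρ (h := w ⌈/⌉ P) t ht _
    fun p d => length_chunk_le _ _ _) fun Y hY => ?_
  refine Takes.bind (Takes.gather ρ Y hY t ht) fun Z _ => ?_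
  exact Takes.pure' trivial (by linarith) (by linarith) (by linarith)

theorem Takes.broadcast (ρ : Rates) (t : ProcTree P Unit) (ht : t.leaves.Nodup)
    (hv : t.volume ≤ 2 * P) (w : ℕ) (x : List ℂ) :
    Takes ρ (broadcast t w x) t.leaves 0 (20 * (w + P)) (10 * t.depth)
      (fun _ => True) := by
  have := ceilDiv_mul_volume_le hv w
  refine Takes.bind (Takes.scatter ρ (h := w ⌈/⌉ P) t ht _
    fun d => length_chunk_le _ _ _) fun Y hY => ?_
  refine Takes.bind (Takes.allGather ρ Y hY t ht) fun Z _ => ?_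
  exact Takes.pure' trivial (by linarith) (by linarith) (by linarith)

/-! ## Matrix multiplication -/

theorem length_pack (I J : ℕ) (A : Mat) : (pack I J A).length = I * J := by
  simp [pack, List.length_flatMap]

theorem length_packUpper_le (n : ℕ) (A : Mat) : (packUpper n A).length ≤ n ^ 2 := by
  rw [packUpper, List.flatMap_def]
  have := length_flatten_le (h := n)
    ((List.range n).map fun j => (List.range (j + 1)).map fun i => A i j) (by
      simp only [List.mem_map, List.mem_range]
      rintro x ⟨j, hj, rfl⟩
      simpa using hj)
  simpa [pow_two] using this

theorem Takes.mulReduce (ρ : Rates) (t : ProcTree P Unit) (ht : t.leaves.Nodup)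
    (hv : t.volume ≤ 2 * P) {μ n I J : ℕ} {mp : Fin P → ℕ} (hμ : ∀ p ∈ t.leaves, mp p ≤ μ)
    (hI : I ≤ n) (hJ : J ≤ n) (X Y : Fin P → Mat) :
    Takes ρ (mulReduce t mp I J X Y) t.leaves (3 * (μ * n ^ 2) + 8 * (n ^ 2 + P))
      (20 * (n ^ 2 + P)) (10 * t.depth) (fun _ => True) := by
  have hIJ : ((I * J : ℕ) : ℝ) ≤ (n : ℝ) ^ 2 := by
    rw [pow_two]
    exact_mod_cast Nat.mul_le_mul hI hJ
  refine Takes.bind (Takes.onEach (a := 3 * (μ * n ^ 2)) (by positivity) t.leaves ht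
    fun p hp => ?_) fun Z _ => ?_
  · simp only [Counted.ops_bind]
    have h₁ := Counted.ops_adjoint_le (mp p) I (X p)
    have h₂ := Counted.ops_matMul_le I J (mp p) (Counted.adjoint (mp p) I (X p)).val (Y p)
    have h₃ : mp p * I ≤ μ * n ^ 2 :=
      (Nat.mul_le_mul (hμ p hp) hI).trans (Counted.le_mul_sq μ n)
    have h₄ : I * J * (2 * mp p) ≤ 2 * (μ * n ^ 2) := by
      calc I * J * (2 * mp p) ≤ n * n * (2 * μ) := by
            gcongr
            exact hμ p hp
        _ = _ := by ring
    exact_mod_cast (by omega : (Counted.adjoint (mp p) I (X p)).ops +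
      (Counted.matMul I J (mp p) (Counted.adjoint (mp p) I (X p)).val (Y p)).ops ≤
        3 * (μ * n ^ 2))
  refine Takes.bind (Takes.reduce ρ t ht hv (I * J) _) fun z _ => ?_
  exact Takes.pure' trivial (by linarith) (by linarith) (by linarith)

theorem Takes.mulBroadcast (ρ : Rates) (t : ProcTree P Unit) (ht : t.leaves.Nodup)
    (hv : t.volume ≤ 2 * P) {μ n K J : ℕ} {mp : Fin P → ℕ} (hμ : ∀ p ∈ t.leaves, mp p ≤ μ)
    (hK : K ≤ n) (hJ : J ≤ n) (X : Fin P → Mat) (B : Mat) :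
    Takes ρ (mulBroadcast t mp K J X B) t.leaves (2 * (μ * n ^ 2))
      (20 * (n ^ 2 + P)) (10 * t.depth) (fun _ => True) := by
  have hKJ : ((K * J : ℕ) : ℝ) ≤ (n : ℝ) ^ 2 := by
    rw [pow_two]
    exact_mod_cast Nat.mul_le_mul hK hJ
  refine Takes.bind (Takes.broadcast ρ t ht hv (K * J) _) fun bs _ => ?_
  refine (Takes.onEach (a := 2 * (μ * n ^ 2)) (by positivity) t.leaves ht
    fun p hp => ?_).mono (by linarith) (by linarith) (by linarith) fun _ => id
  have h₂ := Counted.ops_matMul_le (mp p) J K (X p) (unpack J (bs p))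
  have h₄ : mp p * J * (2 * K) ≤ 2 * (μ * n ^ 2) := by
    calc mp p * J * (2 * K) ≤ μ * n * (2 * n) := by
          gcongr
          exact hμ p hp
      _ = _ := by ring
  exact_mod_cast h₂.trans h₄

/-! ## TSQR -/

theorem LocalQR.nonneg {c : ℝ} (Q : LocalQR c) : 0 ≤ c := by
  have := Q.ops_le 1 1 (fun _ _ => 0) le_rfl
  have h : (0 : ℝ) ≤ ((Q.run 1 1 fun _ _ => 0).ops : ℝ) := by positivity
  norm_num at this
  linarith

/-- Leaves work in parallel on at most `μ` rows; every level above adds the QR decomposition of a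
`2n × n` matrix, costing `2cn³`. The postcondition lets the downsweep inherit the leaves and the
depth of `t`. -/
theorem Takes.upsweep (ρ : Rates) {c : ℝ} (Q : LocalQR c) {n μ : ℕ} {mp : Fin P → ℕ}
    (A : Fin P → Mat) (t : ProcTree P Unit) (ht : t.leaves.Nodup)
    (hn : ∀ p ∈ t.leaves, n ≤ mp p) (hμ : ∀ p ∈ t.leaves, mp p ≤ μ) :
    Takes ρ (upsweep Q n mp A t) t.leaves (c * (μ * n ^ 2) + 2 * c * n ^ 3 * t.depth)
      (2 * n ^ 2 * t.depth) (2 * t.depth) (fun v => v.2.shape = t) := by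
  have hc := Q.nonneg
  induction t with
  | leaf p x =>
    have hp : p ∈ (leaf p x : ProcTree P Unit).leaves := by simp [leaves]
    refine Takes.bind (Takes.onProc (a := c * (μ * n ^ 2)) hp ?_) fun v _ => ?_
    · refine (Q.ops_le _ _ _ (hn p hp)).trans ?_
      rw [mul_assoc]
      gcongr
      exact hμ p hp
    · exact Takes.pure' rfl (by simp [depth]) (by simp [depth]) (by simp [depth])
  | node x l r ihl ihr =>
    obtain ⟨h₁, h₂, h₃⟩ := nodup_node ht
    have hl : ∀ p ∈ l.leaves, p ∈ (node x l r).leaves := fun p hp => List.mem_append_left _ hp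
    have hr : ∀ p ∈ r.leaves, p ∈ (node x l r).leaves := fun p hp => List.mem_append_right _ hp
    change Takes ρ (ParQR.upsweep Q n mp A l >>= fun v => ParQR.upsweep Q n mp A r >>= fun w => do
      let x ← send r.root l.root [packUpper n w.1]
      let bs ← recv x
      let u ← ParQR.onProc l.root (Q.run (2 * n) n (stack n v.1 (unpackUpper n bs.flatten)))
      pure (u.2.2, ProcTree.node (u.1, u.2.1) v.2 w.2)) (l.leaves ++ r.leaves) _ _ _ _
    refine Takes.par (a₁ := c * (μ * n ^ 2) + 2 * c * n ^ 3 * (max l.depth r.depth : ℕ))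
      (b₁ := 2 * n ^ 2 * (max l.depth r.depth : ℕ))
      (c₁ := 2 * (max l.depth r.depth : ℕ)) (post := fun v => v.2.shape = l)
      (post₂ := fun v => v.2.shape = r) h₃
      ((ihl h₁ (fun p hp => hn p (hl p hp)) fun p hp => hμ p (hl p hp)).mono
        (by gcongr; exact le_max_left _ _) (by gcongr; exact le_max_left _ _)
        (by gcongr; exact le_max_left _ _) fun _ => id)
      (fun _ _ => (ihr h₂ (fun p hp => hn p (hr p hp)) fun p hp => hμ p (hr p hp)).mono
        (by gcongr; exact le_max_right _ _) (by gcongr; exact le_max_right _ _)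
        (by gcongr; exact le_max_right _ _) fun _ => id) fun v w hv hw => ?_
    refine Takes.transfer (w := n ^ 2) (by simp [root_mem_leaves]) (by simp [root_mem_leaves])
      (by simpa using mod_cast length_packUpper_le n w.1) ?_
    refine Takes.bind (Takes.onProc (a := 2 * c * n ^ 3) (by simp [root_mem_leaves]) ?_)
      fun u _ => ?_
    · refine (Q.ops_le _ _ _ (by omega)).trans (le_of_eq ?_)
      push_cast
      ring
    · refine Takes.pure' (by simp only [shape, hv, hw]) ?_ ?_ ?_ <;>
      · simp only [depth]
        push_cast
        linarith

theorem Takes.downsweep (ρ : Rates) {n μ : ℕ} {mp : Fin P → ℕ} (F : ProcTree P (Mat × Mat))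
    (hF : F.leaves.Nodup) (hn : ∀ p ∈ F.leaves, n ≤ mp p) (hμ : ∀ p ∈ F.leaves, mp p ≤ μ)
    (B : Mat) (W : Fin P → Mat) :
    Takes ρ (downsweep n mp F B W) F.leaves (8 * (μ * n ^ 2) + 16 * n ^ 3 * F.depth)
      (2 * n ^ 2 * F.depth) (2 * F.depth) (fun _ => True) := by
  induction F generalizing B W with
  | leaf p x =>
    have hp : p ∈ (leaf p x : ProcTree P (Mat × Mat)).leaves := by simp [leaves]
    refine Takes.bind (Takes.onProc (a := 8 * (μ * n ^ 2)) hp ?_) fun v _ => ?_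
    · have h₁ := Counted.ops_applyQ_le (hn p hp) x.1 x.2 (stack n B fun _ _ => 0)
      have h₂ : 8 * (mp p * n ^ 2) ≤ 8 * (μ * n ^ 2) := by
        gcongr
        exact hμ p hp
      exact_mod_cast h₁.trans h₂
    · exact Takes.pure' trivial (by simp [depth]) (by simp [depth]) (by simp [depth])
  | node x l r ihl ihr =>
    obtain ⟨h₁, h₂, h₃⟩ := nodup_node hF
    have hl : ∀ p ∈ l.leaves, p ∈ (node x l r).leaves := fun p hp => List.mem_append_left _ hp
    have hr : ∀ p ∈ r.leaves, p ∈ (node x l r).leaves := fun p hp => List.mem_append_right _ hp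
    change Takes ρ _ (l.leaves ++ r.leaves) _ _ _ _
    refine Takes.bind (Takes.onProc (a := 16 * n ^ 3) (by simp [root_mem_leaves]) ?_)
      fun Y _ => ?_
    · have := Counted.ops_applyQ_le (μ := 2 * n) (ν := n) (by omega) x.1 x.2
        (stack n B fun _ _ => 0)
      exact_mod_cast this.trans (le_of_eq (by ring))
    refine Takes.transfer (w := n ^ 2) (by simp [root_mem_leaves]) (by simp [root_mem_leaves])
      (by simp [length_pack, pow_two]) ?_
    -- The right call is handed the store `W₁` left by the left call, but its cost does not depend
    -- on it, so the two calls still count as parallel.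
    have := Takes.par (g := fun _ w => pure w) (post' := fun _ => True)
      (a := 8 * (μ * n ^ 2) + 16 * n ^ 3 * ((node x l r).depth : ℕ) - 16 * n ^ 3)
      (b := 2 * n ^ 2 * ((node x l r).depth : ℕ) - 0 - 2 * n ^ 2)
      (c := 2 * ((node x l r).depth : ℕ) - 0 - 2)
      (a₁ := 8 * (μ * n ^ 2) + 16 * n ^ 3 * (max l.depth r.depth : ℕ))
      (b₁ := 2 * n ^ 2 * (max l.depth r.depth : ℕ))
      (c₁ := 2 * (max l.depth r.depth : ℕ)) h₃
      ((ihl h₁ (fun p hp => hn p (hl p hp)) (fun p hp => hμ p (hl p hp)) Y W).mono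
        (by gcongr; exact le_max_left _ _) (by gcongr; exact le_max_left _ _)
        (by gcongr; exact le_max_left _ _) fun _ => id)
      (fun W₁ _ => (ihr h₂ (fun p hp => hn p (hr p hp)) (fun p hp => hμ p (hr p hp))
        (unpack n [pack n n fun i j => Y (n + i) j].flatten) W₁).mono
        (by gcongr; exact le_max_right _ _) (by gcongr; exact le_max_right _ _)
        (by gcongr; exact le_max_right _ _) fun _ => id) fun v w _ _ => by
        refine Takes.pure' trivial ?_ ?_ ?_ <;>
        · simp only [depth]
          push_cast
          linarith
    simpa only [bind_pure] using this

/-- The constant `25` is `8` for the leaves of the downsweep, `8 + 5 + 2` for elimination, kernel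
and R-factor on the root, and `2` for the final solves. Upsweep, downsweep and broadcast give `2`
each in the `6` of the other terms. -/
theorem Takes.tsqr (ρ : Rates) {c : ℝ} (Q : LocalQR c) (t : ProcTree P Unit)
    (ht : t.leaves.Nodup) {n μ : ℕ} {mp : Fin P → ℕ} (hn : ∀ p ∈ t.leaves, n ≤ mp p)
    (hμ : ∀ p ∈ t.leaves, mp p ≤ μ) (A : Fin P → Mat) :
    Takes ρ (tsqr Q t n mp A) t.leaves ((c + 25) * (μ * n ^ 2) + (2 * c + 16) * n ^ 3 * t.depth)
      (6 * n ^ 2 * t.depth) (6 * t.depth) (fun _ => True) := by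
  have hr := t.root_mem_leaves
  have h₁ : n ≤ n ^ 3 := Nat.le_self_pow (by norm_num) n
  have h₂ : n ^ 2 ≤ n ^ 3 := by
    rcases Nat.eq_zero_or_pos n with rfl | h
    · simp
    · exact Nat.pow_le_pow_right h (by norm_num)
  have h₃ : (n : ℝ) ^ 3 ≤ μ * n ^ 2 := mod_cast Counted.pow_three_le ((hn _ hr).trans (hμ _ hr))
  refine Takes.bind (Takes.upsweep ρ Q A t ht hn hμ) ?_
  rintro ⟨R₀, F⟩ hF
  have hFl : F.leaves = t.leaves := by rw [← hF, leaves_shape]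
  have hFd : F.depth = t.depth := by rw [← hF, depth_shape]
  have hdown := Takes.downsweep ρ F (by rwa [hFl]) (by rwa [hFl]) (by rwa [hFl])
    (fun i j => if i = j then 1 else 0) fun _ _ _ => 0
  rw [hFl, hFd] at hdown
  refine Takes.bind hdown fun W _ => ?_
  refine Takes.bind (Takes.onProc (a := 8 * n ^ 3) hr ?_) ?_
  · have e : n * (5 + n + 2 * n ^ 2) = 5 * n + n ^ 2 + 2 * n ^ 3 := by ring
    have := Counted.ops_signedLU_le n (W t.root) n
    exact_mod_cast (by omega : (Counted.signedLU n (W t.root) n).ops ≤ 8 * n ^ 3)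
  rintro ⟨X, S⟩ -
  refine Takes.bind (Takes.onProc (a := 5 * n ^ 3) hr ?_) fun T _ => ?_
  · simp only [Counted.ops_bind]
    refine le_trans (Nat.cast_le.2 (add_le_add (Counted.ops_adjoint_le _ _ _)
      (add_le_add (Counted.ops_table_le (N := 2) fun i _ j _ => le_rfl)
        (Counted.ops_solveUpper_le _ _ _ _)))) ?_
    exact_mod_cast (by ring_nf; omega : n * n + (n * n * 2 + 2 * (n * n ^ 2)) ≤ 5 * n ^ 3)
  refine Takes.bind (Takes.onProc (a := 2 * n ^ 3) hr ?_) fun R _ => ?_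
  · refine le_trans (Nat.cast_le.2 (Counted.ops_table_le (N := 2) fun i _ j _ => ?_)) ?_
    · split
      · exact le_rfl
      · exact Nat.zero_le _
    · exact_mod_cast (by ring_nf; omega : n * n * 2 ≤ 2 * n ^ 3)
  refine Takes.bind (Takes.treeBroadcast ρ (h := n ^ 2) t ht _ (length_packUpper_le _ _))
    fun us _ => ?_
  refine Takes.bind (Takes.onEach (a := 2 * (μ * n ^ 2)) (by positivity) t.leaves ht
    fun p hp => ?_) fun V _ => ?_
  · have hs : ∀ k ≤ mp p, 2 * (k * n ^ 2) ≤ 2 * (μ * n ^ 2) := fun k hk => by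
      gcongr
      exact hk.trans (hμ p hp)
    split
    next h =>
      simp only [Counted.ops_bind, Counted.ops_pure, add_zero]
      subst h
      exact_mod_cast (Counted.ops_solveUpper_le _ _ _ _).trans (hs _ (Nat.sub_le _ _))
    next h =>
      exact_mod_cast (Counted.ops_solveUpper_le _ _ _ _).trans (hs _ le_rfl)
  · refine Takes.pure' trivial ?_ ?_ ?_
    · linarith
    · push_cast
      linarith
    · linarith

/-! ## 1D-CAQR-EG -/

/-- Terms linear in `n` are additive over the two halves, so they only carry the base cases.
Quadratic terms lose a quarter in the split, and with the leading factor `4` this quarter pays for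
the current level. In the message count, the two calls save `30 * t.depth` each; one saving pays for
the three collectives and the other is passed on. The invariant `b ≤ 2 * n` keeps base cases from
being too narrow. -/
theorem Takes.caqr (ρ : Rates) {c : ℝ} (Q : LocalQR c) (t : ProcTree P Unit)
    (ht : t.leaves.Nodup) (hv : t.volume ≤ 2 * P) {b : ℕ} (hb : 0 < b) {K : ℝ} (hK : 0 ≤ K)
    (hP : (P : ℝ) ≤ K * b ^ 2) {μ : ℕ} (n : ℕ) (hbn : b ≤ 2 * n) (mp : Fin P → ℕ)
    (hn : ∀ p ∈ t.leaves, n ≤ mp p) (hμ : ∀ p ∈ t.leaves, mp p ≤ μ) (A : Fin P → Mat) :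
    Takes ρ (caqr Q t b hb n mp A) t.leaves
      (4 * (58 + 16 * K + c) * (μ * n ^ 2) + (2 * c + 16) * (n * b ^ 2) * t.depth)
      (4 * (60 + 60 * K) * n ^ 2 + 6 * (n * b) * t.depth)
      (72 * (n / b) * t.depth - 30 * t.depth) (fun _ => True) := by
  have hc := Q.nonneg
  have hb' : (0 : ℝ) < b := by exact_mod_cast hb
  have hr := t.root_mem_leaves
  have hd : (0 : ℝ) ≤ t.depth := by positivity
  induction n using Nat.strong_induction_on generalizing mp A with
  | _ n ih =>
    by_cases h : n ≤ b
    · rw [ParQR.caqr, dif_pos h]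
      have h' : (n : ℝ) ≤ b := by exact_mod_cast h
      refine (Takes.tsqr ρ Q t ht hn hμ A).mono ?_ ?_ ?_ fun _ => id
      · have e : (n : ℝ) ^ 3 = n * n ^ 2 := by ring
        rw [e]
        gcongr
        linarith
      · have e : (n : ℝ) ^ 2 = n * n := by ring
        have h₁ : 6 * (n : ℝ) ^ 2 * t.depth ≤ 6 * (n * b) * t.depth := by
          rw [e]
          gcongr
        have h₂ : 0 ≤ 4 * (60 + 60 * K) * (n : ℝ) ^ 2 := by positivity
        linarith
      -- With `n / b ≥ 1/2` the bound is at least `(36 - 30) * t.depth`, exactly the messages of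
      -- TSQR.
      · have h₁ : (1 / 2 : ℝ) ≤ n / b := by
          rw [div_le_div_iff₀ two_pos hb']
          exact_mod_cast (by omega : 1 * b ≤ n * 2)
        have := mul_le_mul_of_nonneg_right h₁ hd
        linarith
    · rw [ParQR.caqr, dif_neg h]
      have hk : n / 2 ≤ n := Nat.div_le_self _ _
      have hk' : n - n / 2 ≤ n := Nat.sub_le _ _
      have hnμ : n ≤ μ := (hn _ hr).trans (hμ _ hr)
      have hn₃ : n ^ 3 ≤ μ * n ^ 2 := Counted.pow_three_le hnμ
      have hn₂ : n ^ 2 ≤ n ^ 3 := Nat.pow_le_pow_right (by omega) (by norm_num)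
      have hprod : ∀ {x y z : ℕ}, x ≤ n → y ≤ n → z ≤ n → x * y * (2 * z) ≤ 2 * n ^ 3 := by
        intro x y z hx hy hz
        calc x * y * (2 * z) ≤ n * n * (2 * n) := by gcongr
          _ = 2 * n ^ 3 := by ring
      have hsq : ∀ {x y : ℕ}, x ≤ n → y ≤ n → x * y ≤ n ^ 3 := fun hx hy =>
        (Nat.mul_le_mul hx hy).trans ((by ring : n * n = n ^ 2).le.trans hn₂)
      refine Takes.bind (ih (n / 2) (by omega) (by omega) mp (fun p hp => hk.trans (hn p hp)) hμ A)
        ?_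
      rintro ⟨VL, TL, RL⟩ -
      refine Takes.bind (Takes.mulReduce ρ t ht hv hμ hk hk' _ _) fun M₁ _ => ?_
      refine Takes.bind (Takes.onProc (a := 3 * (μ * n ^ 2)) hr ?_) fun M₂ _ => ?_
      · simp only [Counted.ops_bind]
        refine le_trans (Nat.cast_le.2 (add_le_add (Counted.ops_adjoint_le _ _ _)
          (Counted.ops_matMul_le _ _ _ _ _))) ?_
        have h₁ := hsq hk hk
        have h₂ := hprod hk hk' hk
        exact_mod_cast (by omega : n / 2 * (n / 2) + n / 2 * (n - n / 2) * (2 * (n / 2)) ≤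
          3 * (μ * n ^ 2))
      refine Takes.bind (Takes.mulBroadcast ρ t ht hv hμ hk hk' _ _) fun Y _ => ?_
      refine Takes.bind (Takes.onEach (a := μ * n ^ 2) (by positivity) t.leaves ht
        fun p hp => ?_) fun B _ => ?_
      · refine le_trans (Nat.cast_le.2 (Counted.ops_matSub_le _ _ _ _)) ?_
        exact_mod_cast (Nat.mul_le_mul (hμ p hp) hk').trans (Counted.le_mul_sq μ n)
      have hs : ∀ p ∈ t.leaves, mp p - (if p = t.root then n / 2 else 0) ≤ μ := fun p hp =>
        (Nat.sub_le _ _).trans (hμ p hp)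
      refine Takes.bind (ih (n - n / 2) (by omega) (by omega) _ (fun p hp => ?_) hs _) ?_
      -- The root gives up `n / 2` rows and needs only `n - n / 2` for the narrower call.
      · have := hn p hp
        split <;> omega
      rintro ⟨VR, TR, RR⟩ -
      refine Takes.bind (Takes.mulReduce ρ t ht hv hs hk hk' _ _) fun M₃ _ => ?_
      refine Takes.bind (Takes.onProc (a := 2 * (μ * n ^ 2)) hr ?_) fun M₄ _ => ?_
      · refine le_trans (Nat.cast_le.2 (Counted.ops_matMul_le _ _ _ _ _)) ?_
        have h₂ := hprod hk hk' hk'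
        exact_mod_cast (by omega : n / 2 * (n - n / 2) * (2 * (n - n / 2)) ≤ 2 * (μ * n ^ 2))
      refine Takes.bind (Takes.onProc (a := 3 * (μ * n ^ 2)) hr ?_) fun N _ => ?_
      · simp only [Counted.ops_bind]
        refine le_trans (Nat.cast_le.2 (add_le_add (Counted.ops_matMul_le _ _ _ _ _)
          (Counted.ops_table_le (N := 1) fun _ _ _ _ => le_rfl))) ?_
        have h₁ := hsq hk hk'
        have h₂ := hprod hk hk' hk
        exact_mod_cast (by omega : n / 2 * (n - n / 2) * (2 * (n / 2)) + n / 2 * (n - n / 2) * 1 ≤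
          3 * (μ * n ^ 2))
      obtain ⟨x, hx⟩ : ∃ x, n / 2 = x := ⟨_, rfl⟩
      obtain ⟨y, hy⟩ : ∃ y, n - n / 2 = y := ⟨_, rfl⟩
      rw [hy, hx]
      have hxy : (n : ℝ) = x + y := by exact_mod_cast (by omega : n = x + y)
      -- Equivalently `x² + y² ≤ 6xy`, which follows from `x ≤ y ≤ x + 1 ≤ 2x`; the constant is not
      -- `1/2` because `n` may be odd.
      have hquad : (x : ℝ) ^ 2 + y ^ 2 ≤ 3 / 4 * n ^ 2 := by
        have h₁ : (y : ℝ) ≤ x + 1 := by exact_mod_cast (by omega : y ≤ x + 1)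
        have h₂ : (x : ℝ) ≤ y := by exact_mod_cast (by omega : x ≤ y)
        have h₃ : (1 : ℝ) ≤ x := by exact_mod_cast (by omega : 1 ≤ x)
        rw [hxy]
        nlinarith
      -- Here `P = O(b²)` enters: above the threshold, the rounding term of the collectives is
      -- absorbed by `n²`.
      have hPn : (P : ℝ) ≤ K * n ^ 2 := hP.trans (by gcongr; omega)
      have hμ₁ : (1 : ℝ) ≤ μ := by exact_mod_cast (by omega : 1 ≤ μ)
      have hn₂' : (0 : ℝ) ≤ n ^ 2 := by positivity
      have hnn : (n : ℝ) ^ 2 ≤ μ * n ^ 2 := by nlinarith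
      have hKn : K * (n : ℝ) ^ 2 ≤ K * (μ * n ^ 2) := by gcongr
      refine Takes.pure' trivial ?_ ?_ ?_
      · have h₁ := mul_le_mul_of_nonneg_left hquad
          (by positivity : 0 ≤ 4 * (58 + 16 * K + c) * (μ : ℝ))
        have h₂ : 0 ≤ c * ((μ : ℝ) * n ^ 2) := by positivity
        have h₃ : (2 * c + 16) * ((n : ℝ) * b ^ 2) * t.depth =
          (2 * c + 16) * ((x : ℝ) * b ^ 2) * t.depth +
            (2 * c + 16) * ((y : ℝ) * b ^ 2) * t.depth := by
          rw [hxy]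
          ring
        rw [h₃]
        linarith
      · have h₁ := mul_le_mul_of_nonneg_left hquad
          (by positivity : 0 ≤ 4 * (60 + 60 * K))
        have h₃ : 6 * ((n : ℝ) * b) * t.depth =
          6 * ((x : ℝ) * b) * t.depth + 6 * ((y : ℝ) * b) * t.depth := by
          rw [hxy]
          ring
        rw [h₃]
        linarith
      · have h₃ : 72 * ((n : ℝ) / b) * t.depth =
          72 * ((x : ℝ) / b) * t.depth + 72 * ((y : ℝ) / b) * t.depth := by
          rw [hxy]
          ring
        rw [h₃]
        linarith

/-! ## Balanced distributions -/

theorem sum_length_ownedRows {m : ℕ} (own : Fin m → Fin P) :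
    ∑ p, (ownedRows own p).length = m := by
  have h : ∀ p, (ownedRows own p).length = (Finset.univ.filter fun i => own i = p).card := by
    intro p
    rw [ownedRows, ← List.toFinset_card_of_nodup ((List.nodup_finRange m).filter _)]
    congr 1
    ext i
    simp
  simp only [h]
  rw [← Finset.card_eq_sum_card_fiberwise (fun _ _ => Finset.mem_univ _)]
  simp

/-- Summing the balance condition over `q` shows that `P` times the length is at most `m + P`. -/
theorem length_ownedRows_le {m : ℕ} (own : Fin m → Fin P)
    (h : ∀ p q, (ownedRows own p).length ≤ (ownedRows own q).length + 1) (p : Fin P) :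
    (ownedRows own p).length ≤ m / P + 1 := by
  have h₁ := Finset.card_nsmul_le_sum Finset.univ (fun q => (ownedRows own q).length + 1)
    (ownedRows own p).length fun q _ => h p q
  rw [Finset.sum_add_distrib, sum_length_ownedRows] at h₁
  simp at h₁
  rw [← Nat.add_div_right _ p.pos, Nat.le_div_iff_mul_le p.pos, mul_comm]
  exact h₁

/-- If `p` owned `k < n` rows, the others would own at most `k + 1` and `p` itself fewer than that,
so `m < P(k + 1) ≤ Pn`. -/
theorem le_length_ownedRows {m n : ℕ} (own : Fin m → Fin P) (hn : P * n ≤ m)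
    (h : ∀ p q, (ownedRows own p).length ≤ (ownedRows own q).length + 1) (p : Fin P) :
    n ≤ (ownedRows own p).length := by
  by_contra! hlt
  have h₁ := Finset.sum_lt_sum (s := Finset.univ) (f := fun q => (ownedRows own q).length)
    (g := fun _ => (ownedRows own p).length + 1) (fun q _ => h q p)
    ⟨p, Finset.mem_univ p, Nat.lt_succ_self _⟩
  rw [sum_length_ownedRows] at h₁
  simp at h₁
  have : P * ((ownedRows own p).length + 1) ≤ P * n := Nat.mul_le_mul_left P hlt
  omega

/-! ### The processor tree of the execution. -/

theorem depth_build_le {P : ℕ} (r : Fin P) :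
    ((ProcTree.build r ((List.finRange P).filter fun p => p ≠ r)).depth : ℝ) ≤
      2 * Real.logb 2 P := by
  have hlen : ((List.finRange P).filter fun p => p ≠ r).length + 1 = P := by
    have h := List.length_eq_length_filter_add (l := List.finRange P) (fun p => decide (p ≠ r))
    have h₁ : ((List.finRange P).filter fun p => !decide (p ≠ r)).length = 1 := by
      have := List.count_eq_one_of_mem (List.nodup_finRange P) (List.mem_finRange r)
      rw [List.count_eq_length_filter] at this
      rw [← this]
      congr 2
      funext p
      by_cases hp : p = r <;> simp [hp]
    rw [List.length_finRange, h₁] at h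
    exact h.symm
  have h := (ProcTree.build_spec r ((List.finRange P).filter fun p => p ≠ r)).2.2.2 (Nat.clog 2 P)
    (by rw [hlen]; exact Nat.le_pow_clog one_lt_two P)
  -- For `P ≥ 2` the logarithm is at least `1`, so doubling absorbs the rounding; for `P = 1` both
  -- sides vanish.
  have h₁ : ((Nat.clog 2 P : ℕ) : ℝ) ≤ 2 * Real.logb 2 P := by
    rcases Nat.lt_or_ge P 2 with hP | hP
    · obtain rfl : P = 1 := by have := r.pos; omega
      simp
    · have hP' : (2 : ℝ) ≤ P := by exact_mod_cast hP
      have h₂ : 1 ≤ Real.logb 2 P := by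
        rw [Real.le_logb_iff_rpow_le one_lt_two (by linarith), Real.rpow_one]
        exact hP'
      have h₃ := Nat.ceil_lt_add_one (zero_le_one.trans h₂)
      have h₄ := Real.natCeil_logb_natCast 2 P
      norm_num at h₄
      rw [h₄] at h₃
      linarith
  exact (Nat.cast_le.2 h).trans h₁

theorem nodup_cons_filter_ne {P : ℕ} (r : Fin P) :
    (r :: (List.finRange P).filter fun p => p ≠ r).Nodup := by
  rw [List.nodup_cons]
  exact ⟨by simp, (List.nodup_finRange P).filter _⟩

end ParQR

/-! ### Assembly of the runtime bound. -/

open ParQR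
theorem lemma6 (K c : ℝ) :
    ∃ C : ℝ, ∀ (Q : LocalQR c) (P m n b : ℕ) (hb : 0 < b) (r : Fin P) (own : Fin m → Fin P)
      (A : Matrix (Fin m) (Fin n) ℂ) (γ β α : ℝ),
      0 ≤ γ → 0 ≤ β → 0 ≤ α →
      b ≤ n →
      P * n ≤ m →
      (P : ℝ) ≤ K * (b : ℝ) ^ 2 →
      (∀ i : Fin m, (i : ℕ) < n → own i = r) →
      (∀ p q : Fin P, (ownedRows own p).length ≤ (ownedRows own q).length + 1) →
      runtime γ β α (caqrExecution Q b hb r own A) ≤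
        γ * (C * ((m : ℝ) * (n : ℝ) ^ 2 / P + n * (b : ℝ) ^ 2 * Real.logb 2 P)) +
        β * (C * ((n : ℝ) ^ 2 + n * b * Real.logb 2 P)) +
        α * (C * ((n : ℝ) / b * Real.logb 2 P)) := by
  -- A sum of constants from `Takes.caqr`: the first is doubled because `m/P + 1 ≤ 2m/P`, and `144 =
  -- 2 * 72` because the depth is at most `2 log₂ P`. The other coefficients with `log P` are
  -- smaller than this sum.
  refine ⟨8 * (58 + 16 * K + c) + 4 * (60 + 60 * K) + 144, ?_⟩
  intro Q P m n b hb r own A γ β α hγ hβ hα hbn hPn hK _ hbal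
  set C := 8 * (58 + 16 * K + c) + 4 * (60 + 60 * K) + 144 with hC
  have hc := Q.nonneg
  have hP₀ : (0 : ℝ) < P := by exact_mod_cast r.pos
  have hb₀ : (0 : ℝ) < b := by exact_mod_cast hb
  have hK₀ : 0 ≤ K := by
    by_contra! h
    have : K * (b : ℝ) ^ 2 ≤ 0 := mul_nonpos_of_nonpos_of_nonneg h.le (by positivity)
    linarith
  set ps := (List.finRange P).filter fun p => p ≠ r with hps
  set t := ProcTree.build r ps with ht
  obtain ⟨hl, -, hv, -⟩ := ProcTree.build_spec r ps
  have hlog : (t.depth : ℝ) ≤ 2 * Real.logb 2 P := depth_build_le r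
  have hlog₀ : 0 ≤ Real.logb 2 P := by
    have : (0 : ℝ) ≤ t.depth := by positivity
    linarith
  have hpsP : ps.length ≤ P :=
    (List.length_filter_le _ _).trans (by simp)
  have key := Takes.caqr (μ := m / P + 1) ⟨γ, β, α, hγ, hβ, hα⟩ Q t
    (by rw [hl]; exact nodup_cons_filter_ne r) (hv.trans (by omega)) hb hK₀ hK n (by omega)
    (fun p => (ownedRows own p).length) (fun p _ => le_length_ownedRows own hPn hbal p)
    (fun p _ => length_ownedRows_le own hbal p) (ownedBlock own A) []
  have hmem : ∀ p, p ∈ t.leaves := fun p => by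
    rw [hl]
    by_cases h : p = r
    · simp [h]
    · exact List.mem_cons_of_mem _ (List.mem_filter.2 ⟨List.mem_finRange p, by simpa using h⟩)
  -- The execution starts from the empty list of tasks, where all clocks are `0`.
  have hbound := key.2.2 0 fun _ _ => le_rfl
  rw [zero_add] at hbound
  have hμ : ((m / P + 1 : ℕ) : ℝ) ≤ 2 * (m / P) := by
    have h₁ : ((m / P : ℕ) : ℝ) ≤ m / P := Nat.cast_div_le
    -- From `P * n ≤ m` and `n ≥ b ≥ 1`.
    have h₂ : (1 : ℝ) ≤ m / P := by
      rw [one_le_div hP₀]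
      exact_mod_cast (Nat.le_mul_of_pos_right P (by omega)).trans hPn
    push_cast
    linarith
  have hRHS : γ * (C * ((m : ℝ) * (n : ℝ) ^ 2 / P + n * (b : ℝ) ^ 2 * Real.logb 2 P)) +
        β * (C * ((n : ℝ) ^ 2 + n * b * Real.logb 2 P)) +
        α * (C * ((n : ℝ) / b * Real.logb 2 P)) =
      (⟨γ, β, α, hγ, hβ, hα⟩ : Rates).cost
        (C * ((m : ℝ) * (n : ℝ) ^ 2 / P + n * (b : ℝ) ^ 2 * Real.logb 2 P))
        (C * ((n : ℝ) ^ 2 + n * b * Real.logb 2 P)) (C * ((n : ℝ) / b * Real.logb 2 P)) := rfl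
  rw [hRHS]
  have hC₀ : 0 ≤ C := by positivity
  refine runtime_le ⟨γ, β, α, hγ, hβ, hα⟩ _ _ (Rates.cost_nonneg _ (by positivity) (by positivity)
    (by positivity)) fun p => (hbound p (hmem p)).trans (Rates.cost_mono _ ?_ ?_ ?_)
  · have h₁ : 4 * (58 + 16 * K + c) * (((m / P + 1 : ℕ) : ℝ) * n ^ 2) ≤
        C * ((m : ℝ) * (n : ℝ) ^ 2 / P) := by
      calc 4 * (58 + 16 * K + c) * (((m / P + 1 : ℕ) : ℝ) * n ^ 2)
          ≤ 4 * (58 + 16 * K + c) * (2 * (m / P) * n ^ 2) := by gcongr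
        _ = 8 * (58 + 16 * K + c) * ((m : ℝ) * (n : ℝ) ^ 2 / P) := by ring
        _ ≤ _ := by gcongr; linarith
    have h₂ : (2 * c + 16) * ((n : ℝ) * b ^ 2) * t.depth ≤
        C * (n * (b : ℝ) ^ 2 * Real.logb 2 P) := by
      calc (2 * c + 16) * ((n : ℝ) * b ^ 2) * t.depth
          ≤ (2 * c + 16) * ((n : ℝ) * b ^ 2) * (2 * Real.logb 2 P) := by gcongr
        _ = (4 * c + 32) * (n * (b : ℝ) ^ 2 * Real.logb 2 P) := by ring
        _ ≤ _ := by gcongr; linarith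
    linarith
  · have h₁ : 4 * (60 + 60 * K) * (n : ℝ) ^ 2 ≤ C * (n : ℝ) ^ 2 := by gcongr; linarith
    have h₂ : 6 * ((n : ℝ) * b) * t.depth ≤ C * (n * b * Real.logb 2 P) := by
      calc 6 * ((n : ℝ) * b) * t.depth ≤ 6 * ((n : ℝ) * b) * (2 * Real.logb 2 P) := by gcongr
        _ = 12 * (n * b * Real.logb 2 P) := by ring
        _ ≤ _ := by gcongr; linarith
    linarith
  · have h₂ : 72 * ((n : ℝ) / b) * t.depth ≤ C * (n / b * Real.logb 2 P) := by
      calc 72 * ((n : ℝ) / b) * t.depth ≤ 72 * ((n : ℝ) / b) * (2 * Real.logb 2 P) := by gcongr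
        _ = 144 * (n / b * Real.logb 2 P) := by ring
        _ ≤ _ := by gcongr; linarith
    have : (0 : ℝ) ≤ t.depth := by positivity
    linarith
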